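/- All graphs are finite and simple. A 3-decomposition of a graph $G$ is a triple $(T,C,M)$ of subgraphs of $G$, where $T$ is a spanning tree of $G$, $C$ is a (possibly empty) 2-regular subgraph and $M$ is a (possibly empty) matching, i.e. a 1-regular subgraph, such that every edge of $G$ lies in exactly one of $T$, $C$, $M$. The 3-decomposition conjecture asserts that every connected cubic graph has a 3-decomposition. A graph is 3-connected if it has more than 3 vertices and deleting any set of fewer than 3 vertices leaves it connected. Consider the following six graphs: - the triangle $K_3$; - the complete bipartite graph $K_{2,3}$; - the Petersen graph with one vertex removed; - the claw-square: the graph on the 8 vertices $a_1,a_2,a_3,a_4,b_1,b_2,b_3,c$ with the 10 edges $a_1a_2,\ a_2a_3,\ a_3a_4,\ a_4a_1,\ cb_1,\ cb_2,\ cb_3,\ a_1b_1,\ a_2b_2,\ a_3b_3$; - the twin-house: the graph on the 6 vertices $u_1,\dots,u_6$ with the 7 edges $u_1u_2,\ u_1u_5,\ u_2u_6,\ u_5u_3,\ u_5u_4,\ u_6u_3,\ u_6u_4$; - the domino: the graph on the 6 vertices $u_1,\dots,u_6$ with the 7 edges $u_1u_2,\ u_1u_5,\ u_2u_6,\ u_5u_6,\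 u_5u_3,\ u_6u_4,\ u_3u_4$. Theorem. Let $G$ be a minimum counterexample to the 3-decomposition conjecture amongst all 3-connected cubic graphs, that is, $G$ is a 3-connected cubic graph without a 3-decomposition, and every 3-connected cubic graph with fewer vertices than $G$ has a 3-decomposition. Then $G$ contains none of the six graphs above as a (not necessarily induced) subgraph. In particular, (i) the girth of $G$ is at least 4; (ii) every cycle of length 4, 5 or 6 in $G$ is an induced subgraph of $G$; and (iii) every edge of $G$ is the centre edge of an induced path $P_6$ on 6 vertices. -/

import Mathlib

namespace ThreeDecomposition

universe u

/-- `G` is `k`-connected: it has more than `k` vertices and stays connected after the deletion of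
any set of fewer than `k` vertices. -/
def IsKConnected {V : Type u} [Fintype V] (G : SimpleGraph V) (k : ℕ) : Prop :=
  k < Fintype.card V ∧ ∀ X : Finset V, X.card < k → (G.induce {v | v ∉ X}).Connected

/-- `(T, C, M)` is a 3-decomposition of `G`: a spanning tree, a (possibly empty) 2-regular subgraph
and a (possibly empty) matching, such that each edge of `G` is in exactly one of the three. -/
structure IsThreeDecomposition {V : Type u} (G : SimpleGraph V) (T C M : G.Subgraph) : Prop where
  spanning : T.IsSpanning
  tree : T.coe.IsTree
  two_regular : ∀ v ∈ C.verts, (C.neighborSet v).ncard = 2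
  matching : M.IsMatching
  cover : T.edgeSet ∪ C.edgeSet ∪ M.edgeSet = G.edgeSet
  disjoint_TC : Disjoint T.edgeSet C.edgeSet
  disjoint_TM : Disjoint T.edgeSet M.edgeSet
  disjoint_CM : Disjoint C.edgeSet M.edgeSet

def HasThreeDecomposition {V : Type u} (G : SimpleGraph V) : Prop :=
  ∃ T C M : G.Subgraph, IsThreeDecomposition G T C M

/-- `G` is a minimum counterexample to the 3-decomposition conjecture amongst all 3-connected cubic
graphs: it is 3-connected and cubic, has no 3-decomposition, and every 3-connected cubic graph with
fewer vertices has one. -/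
structure IsMinimumCounterexample {V : Type u} [Fintype V] (G : SimpleGraph V)
    [DecidableRel G.Adj] : Prop where
  cubic : G.IsRegularOfDegree 3
  threeConnected : IsKConnected G 3
  counterexample : ¬ HasThreeDecomposition G
  minimum : ∀ (W : Type u) [Fintype W] (H : SimpleGraph W) [DecidableRel H.Adj],
    Fintype.card W < Fintype.card V → H.IsRegularOfDegree 3 → IsKConnected H 3 →
      HasThreeDecomposition H

/-- The triangle `K₃`. -/
def triangle : SimpleGraph (Fin 3) := ⊤

/-- The complete bipartite graph `K_{2,3}`. -/
def k23 : SimpleGraph (Fin 2 ⊕ Fin 3) := completeBipartiteGraph (Fin 2) (Fin 3)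

/-- The Petersen graph: an outer 5-cycle `0 1 2 3 4`, an inner pentagram `5 7 9 6 8` and the spokes
between `i` and `i + 5`. -/
def petersen : SimpleGraph (Fin 10) :=
  SimpleGraph.fromEdgeSet
    {s(0, 1), s(1, 2), s(2, 3), s(3, 4), s(4, 0),
     s(0, 5), s(1, 6), s(2, 7), s(3, 8), s(4, 9),
     s(5, 7), s(7, 9), s(9, 6), s(6, 8), s(8, 5)}

/-- The Petersen graph with one vertex removed (all choices of the vertex are equivalent). -/
def petersenMinusVertex : SimpleGraph {v : Fin 10 | v ≠ 0} := petersen.induce {v | v ≠ 0}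

/-- The claw-square: a square `0 1 2 3` and a claw with centre `7` and leaves `4`, `5`, `6`, where
the three leaves are joined to the three distinct vertices `0`, `1`, `2` of the square. -/
def clawSquare : SimpleGraph (Fin 8) :=
  SimpleGraph.fromEdgeSet
    {s(0, 1), s(1, 2), s(2, 3), s(3, 0),
     s(7, 4), s(7, 5), s(7, 6),
     s(0, 4), s(1, 5), s(2, 6)}

/-- The twin-house: a square `2 4 3 5` whose opposite vertices `4` and `5` are joined by the
additional path `4 0 1 5`. -/
def twinHouse : SimpleGraph (Fin 6) :=
  SimpleGraph.fromEdgeSet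
    {s(0, 1), s(0, 4), s(1, 5), s(4, 2), s(4, 3), s(5, 2), s(5, 3)}

/-- The domino: two squares `0 1 5 4` and `4 5 3 2` that share exactly the edge `4 5`. -/
def domino : SimpleGraph (Fin 6) :=
  SimpleGraph.fromEdgeSet
    {s(0, 1), s(0, 4), s(1, 5), s(4, 5), s(4, 2), s(5, 3), s(2, 3)}

end ThreeDecomposition

/-! In a cubic graph, 3-decompositions amount to good trees: spanning trees such that the ends of
every cotree edge have equal tree degree. This degree is 1 or 2; the cotree edges of the first kind
form the 2-regular part, those of the second kind the matching (`exists_isGoodTree`,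
`IsGoodTree.hasThreeDecomposition`). Also, a cubic graph is 3-connected exactly if all its edge cuts
have at least 3 edges, so smaller instances can be built as multigraphs and verified by counting
cuts.

The six configurations are excluded by replacement. Take a copy of the configuration out of the
graph and plug a smaller piece into the three or four half-edges that remain: a vertex for the
triangle, `K_{2,3}` and the Petersen piece, a square for the claw-square and the twin-house, an edge
or a square for the domino. By minimality the new graph has a good tree. Its outer part sees only a
finite interface: which half-edges are in the tree, which tree degree is expected at the others,
which tree half-edges are joined inside, and how many components the inside has. Every inner forest
of the configuration with this interface yields a good tree of the original graph
(`IsGoodTree.exists_trace`, `IsInner.exists_isGoodTree`), and a finite computation finds one for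
almost every interface.

The exceptional interfaces are repaired by moving a matching half-edge into the tree, at the price
of one more inner component (`IsOuter.absorb`). One such move suffices for the Petersen piece. The
domino needs two. There the square is used only if contraction to an edge creates a small cut, and
this very cut controls the outer forest (`IsOuter.reachable_or`).

The remaining claims are local. A chord of a short cycle creates a triangle or a domino. If an edge
is not the centre of an induced `P₆`, then the absence of triangles, `K_{2,3}`, twin-houses and
dominoes forces its surroundings to be a Petersen graph. -/

namespace ThreeDecomposition

universe u

/-! ### Edge multiplicities, and 3-connectivity versus 3-edge-connectivity in cubic graphs -/

section Weights
open Finset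

variable {V : Type u}

open Classical in
/-- The adjacency indicator of a graph. -/
noncomputable def wt {V : Type u} (G : SimpleGraph V) (u v : V) : ℕ := if G.Adj u v then 1 else 0

/-- The degree of a vertex with respect to edge multiplicities `w`. -/
def deg [Fintype V] (w : V → V → ℕ) (v : V) : ℕ := ∑ x, w v x

/-- The total multiplicity of the edges that leave `{u | z u}`. -/
def cut [Fintype V] (w : V → V → ℕ) (z : V → Bool) : ℕ := ∑ u, ∑ v, if z u && !z v then w u v else 0

/-- `w` are the edge multiplicities of a loopless 3-edge-connected cubic multigraph. -/
structure IsCubicMultigraph [Fintype V] (w : V → V → ℕ) : Prop where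
  symm : ∀ u v, w u v = w v u
  diag : ∀ v, w v v = 0
  deg_eq : ∀ v, deg w v = 3
  three_le_cut : ∀ z : V → Bool, (∃ u, z u = true) → (∃ v, z v = false) → 3 ≤ cut w z

theorem wt_comm (G : SimpleGraph V) (u v : V) : wt G u v = wt G v u := by
  by_cases h : G.Adj u v
  · simp [wt, h, h.symm]
  · have h' := mt SimpleGraph.Adj.symm h
    simp [wt, h, h']

theorem wt_self (G : SimpleGraph V) (v : V) : wt G v v = 0 := by simp [wt]

theorem wt_le_one (G : SimpleGraph V) (u v : V) : wt G u v ≤ 1 := by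
  unfold wt; split <;> simp

theorem wt_of_adj {G : SimpleGraph V} {u v : V} (h : G.Adj u v) : wt G u v = 1 := by simp [wt, h]

theorem wt_of_not_adj {G : SimpleGraph V} {u v : V} (h : ¬G.Adj u v) : wt G u v = 0 := by
  simp [wt, h]

theorem wt_ne_zero {G : SimpleGraph V} {u v : V} : wt G u v ≠ 0 ↔ G.Adj u v := by simp [wt]

variable [Fintype V]

theorem deg_wt (G : SimpleGraph V) [DecidableRel G.Adj] (v : V) : deg (wt G) v = G.degree v := by
  rw [← SimpleGraph.card_neighborFinset_eq_degree, SimpleGraph.neighborFinset_eq_filter,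
    Finset.card_filter]
  exact Finset.sum_congr rfl fun x _ => by by_cases h : G.Adj v x <;> simp [wt, h]

theorem cut_compl {w : V → V → ℕ} (hw : ∀ u v, w u v = w v u) (z : V → Bool) :
    cut w (fun v => !z v) = cut w z := by
  unfold cut
  rw [Finset.sum_comm]
  refine Finset.sum_congr rfl fun u _ => Finset.sum_congr rfl fun v _ => ?_
  rw [hw v u]
  cases hu : z u <;> cases hv : z v <;> simp [hu, hv]

theorem reachable_induct {V : Type u} {G : SimpleGraph V} {Z : V → Prop}
    (hZ : ∀ u v, G.Adj u v → Z u → Z v) {a b : V} (h : G.Reachable a b) (ha : Z a) : Z b := by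
  obtain ⟨p⟩ := h
  induction p with
  | nil => exact ha
  | cons hadj _ ih => exact ih (hZ _ _ hadj ha)

/-- Deleting the ends of the cut edges on one side separates the graph, unless that side consists of
such ends only. In this case it has at most two vertices, and degrees decide. -/
theorem isCubicMultigraph_wt {G : SimpleGraph V} [DecidableRel G.Adj]
    (hd : G.IsRegularOfDegree 3) (hc : IsKConnected G 3) : IsCubicMultigraph (wt G) := by
  classical
  have hdeg : ∀ v, deg (wt G) v = 3 := fun v => by rw [deg_wt, hd v]
  refine ⟨wt_comm G, wt_self G, hdeg, fun z ⟨a, ha⟩ ⟨b, hb⟩ => ?_⟩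
  by_contra hlt
  have hlt : cut (wt G) z < 3 := by omega
  set X : Finset V := univ.filter fun u => z u = true ∧ ∃ v, z v = false ∧ G.Adj u v with hX
  have hXc : X.card ≤ cut (wt G) z := by
    rw [hX, Finset.card_filter]
    refine Finset.sum_le_sum fun u _ => ?_
    split_ifs with h
    · obtain ⟨h1, v, h2, h3⟩ := h
      refine le_trans ?_ (Finset.single_le_sum (f := fun v => if z u && !z v then wt G u v else 0)
        (fun _ _ => Nat.zero_le _) (Finset.mem_univ v))
      simp [h1, h2, wt_of_adj h3]
    · exact Nat.zero_le _
  by_cases hex : ∃ u, z u = true ∧ u ∉ X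
  · obtain ⟨u, hu, huX⟩ := hex
    have hbX : b ∉ X := by simp [hX, hb]
    have hr := (hc.2 X (lt_of_le_of_lt hXc hlt)).preconnected ⟨u, huX⟩ ⟨b, hbX⟩
    have := reachable_induct (Z := fun x => z x.1 = true) ?_ hr hu
    · simp [hb] at this
    · rintro ⟨x, hx⟩ ⟨y, hy⟩ hxy hzx
      by_contra hzy
      apply hx
      simp only [hX, Finset.mem_filter, Finset.mem_univ, true_and]
      exact ⟨hzx, y, by simpa using hzy, hxy⟩
  · push Not at hex
    set S : Finset V := univ.filter fun u => z u = true with hS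
    have hSX : S.card ≤ X.card := Finset.card_le_card fun u hu => hex u (by simpa [hS] using hu)
    have hS1 : 1 ≤ S.card := Finset.card_pos.2 ⟨a, by simp [hS, ha]⟩
    -- A vertex of `S` spends at most `S.card - 1` of its three edges inside `S`. One vertex thus
    -- sends out 3 edges, and two vertices send out at least 4.
    have hlow : ∀ u ∈ S, 3 - (S.card - 1) ≤ ∑ v, if z u && !z v then wt G u v else 0 := by
      intro u hu
      have hzu : z u = true := by simpa [hS] using hu
      have h3 := hdeg u
      have hsplit : deg (wt G) u ≤ (∑ v, if z u && !z v then wt G u v else 0) +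
          (S.erase u).card := by
        have : (S.erase u).card = ∑ v, if v ∈ S.erase u then 1 else 0 := by
          rw [Finset.sum_ite_mem]; simp
        rw [this, deg, ← Finset.sum_add_distrib]
        refine Finset.sum_le_sum fun v _ => ?_
        have := wt_le_one G u v
        rcases eq_or_ne v u with rfl | hvu
        · simp [wt_self]
        · by_cases hzv : z v = true
          · simp [hS, hzv, hvu, this]
          · simp [hzu, hzv]
      rw [Finset.card_erase_of_mem hu] at hsplit
      omega
    have hsum : S.card * (3 - (S.card - 1)) ≤ cut (wt G) z := by
      rw [← smul_eq_mul, ← Finset.sum_const]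
      refine le_trans (Finset.sum_le_sum hlow) ?_
      exact Finset.sum_le_sum_of_subset (Finset.subset_univ _)
    have : S.card = 1 ∨ S.card = 2 := by omega
    rcases this with h | h <;> rw [h] at hsum <;> omega

/-- Since `x` has at most one edge that avoids `A`, the cut around `B` forces two edges from `y` to
`B`, so `y` has at most one edge that avoids `B`. Then at most two edges leave `A ∪ {x}`. -/
theorem not_separated_by_pair {G : SimpleGraph V} (hG : IsCubicMultigraph (wt G))
    {A B : V → Bool} {x y : V} (hxy : x ≠ y) (hA : ∃ a, A a = true) (hB : ∃ b, B b = true)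
    (hcov : ∀ v, A v = true ∨ B v = true ∨ v = x ∨ v = y)
    (hAB : ∀ u v, A u = true → B v = true → ¬G.Adj u v)
    (hdis : ∀ v, A v = true → B v = false) (hAx : A x = false) (hAy : A y = false)
    (hBx : B x = false) (hBy : B y = false)
    (h2 : 2 ≤ ∑ v, if A v then wt G x v else 0) : False := by
  classical
  have hsum : ∀ x' y' : V, x' ≠ y' → A x' = false → B x' = false → A y' = false → B y' = false →
      (∑ v, if A v then wt G x' v else 0) + (∑ v, if B v then wt G x' v else 0) + wt G x' y'
        ≤ 3 := by
    intro x' y' hne h1 h2 h3 h4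
    rw [← hG.deg_eq x', deg]
    have : wt G x' y' = ∑ v, if v = y' then wt G x' v else 0 := by simp
    rw [this, ← Finset.sum_add_distrib, ← Finset.sum_add_distrib]
    refine Finset.sum_le_sum fun v _ => ?_
    rcases eq_or_ne v y' with rfl | hv
    · simp [h3, h4]
    · have := hdis v
      cases hAv : A v <;> cases hBv : B v <;> simp_all
  have hx := hsum x y hxy hAx hBx hAy hBy
  have hy := hsum y x hxy.symm hAy hBy hAx hBx
  have hcutle : ∀ P Q : V → Bool, (∀ v, P v = true ∨ Q v = true ∨ v = x ∨ v = y) →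
      (∀ u v, P u = true → Q v = true → ¬G.Adj u v) →
      cut (wt G) P ≤ (∑ v, if P v then wt G x v else 0) + (∑ v, if P v then wt G y v else 0) := by
    intro P Q hcv hPQ
    rw [← Finset.sum_add_distrib]
    refine Finset.sum_le_sum fun u _ => ?_
    by_cases hP : P u = true
    · calc (∑ v, if P u && !P v then wt G u v else 0)
          ≤ ∑ v, ((if v = x then wt G u v else 0) + (if v = y then wt G u v else 0)) := by
            refine Finset.sum_le_sum fun v _ => ?_
            rcases hcv v with h | h | h | h
            · simp [h]
            · simp [wt_of_not_adj (hPQ u v hP h)]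
            · rw [h]; split_ifs <;> simp_all
            · rw [h]; split_ifs <;> simp_all
        _ = _ := by simp [Finset.sum_add_distrib, hP, wt_comm G u]
    · simp [hP]
  obtain ⟨a, ha⟩ := hA
  obtain ⟨b, hb⟩ := hB
  have hbA : A b = false := by
    by_contra h; simp [hdis b (by simpa using h)] at hb
  have cA := hG.three_le_cut A ⟨a, ha⟩ ⟨x, hAx⟩
  have cB := hG.three_le_cut B ⟨b, hb⟩ ⟨x, hBx⟩
  have lA := hcutle A B hcov hAB
  have lB := hcutle B A (fun v => by have := hcov v; tauto)
    (fun u v hu hv h => hAB v u hv hu h.symm)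
  have hBA : ∀ v, B v = true → A v = false := fun v hv => by
    by_contra h; simp [hdis v (by simpa using h)] at hv
  have cA' := hG.three_le_cut (fun v => A v || decide (v = x)) ⟨a, by simp [ha]⟩
    ⟨y, by simp [hAy, hxy.symm]⟩
  have lA' : cut (wt G) (fun v => A v || decide (v = x)) ≤
      (∑ u, if A u then wt G y u else 0) + ((∑ v, if B v then wt G x v else 0) + wt G x y) := by
    have e1 : (∑ u, if A u then wt G y u else 0) =
        ∑ u, ∑ v, if A u = true ∧ v = y then wt G u v else 0 := by
      refine Finset.sum_congr rfl fun u _ => ?_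
      cases A u <;> simp [wt_comm G u]
    have e2 : (∑ v, if B v then wt G x v else 0) =
        ∑ u, ∑ v, if u = x ∧ B v = true then wt G u v else 0 := by
      rw [Finset.sum_comm]
      refine Finset.sum_congr rfl fun u _ => ?_
      cases B u <;> simp
    have e3 : wt G x y = ∑ u, ∑ v, if u = x ∧ v = y then wt G u v else 0 := by
      rw [Finset.sum_eq_single x]
      · simp
      · intro u _ hu; simp [hu]
      · simp
    rw [e1, e2, e3, ← Finset.sum_add_distrib, ← Finset.sum_add_distrib]
    refine Finset.sum_le_sum fun u _ => ?_
    rw [← Finset.sum_add_distrib, ← Finset.sum_add_distrib]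
    refine Finset.sum_le_sum fun v _ => ?_
    by_cases hux : u = x
    · rcases hcov v with h | h | h | h
      · simp [h]
      · simp only [hux, h, and_self, if_true]
        exact le_trans (by split_ifs <;> simp) (Nat.le_add_left _ _ |>.trans' (Nat.le_add_right _ _))
      · simp [h]
      · simp only [hux, h, and_self, if_true]
        exact le_trans (by split_ifs <;> simp) (Nat.le_add_left _ _ |>.trans' (Nat.le_add_left _ _))
    · by_cases hAu : A u = true
      · rcases hcov v with h | h | h | h
        · simp [h]
        · simp [wt_of_not_adj (hAB u v hAu h)]
        · simp [h]
        · simp only [h, hAu, and_self, if_true]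
          exact le_trans (by split_ifs <;> simp) (Nat.le_add_right _ _)
      · simp [hux, hAu]
  omega

/-- If `X` separates `A` from `B`, then at least 3 edges run from `X` to each of them. Cubicity
gives `X.card = 2`, and one of the two vertices has two edges into `A`. -/
theorem isKConnected_three {G : SimpleGraph V} (hG : IsCubicMultigraph (wt G)) [Nonempty V] :
    IsKConnected G 3 := by
  classical
  have hcard : 3 < Fintype.card V := by
    obtain ⟨v⟩ := ‹Nonempty V›
    have h : deg (wt G) v ≤ ∑ x, if x ∈ univ.erase v then 1 else 0 := by
      refine Finset.sum_le_sum fun x _ => ?_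
      rcases eq_or_ne x v with rfl | hx
      · simp [wt_self]
      · simp [hx, wt_le_one]
    rw [hG.deg_eq] at h
    have h2 : (univ.erase v).card = Fintype.card V - 1 := by
      rw [Finset.card_erase_of_mem (Finset.mem_univ v), Finset.card_univ]
    simp only [Finset.sum_ite_mem, Finset.univ_inter, Finset.sum_const, smul_eq_mul,
      mul_one] at h
    omega
  refine ⟨hcard, fun X hX => ?_⟩
  have hne : ∃ v, v ∉ X := by
    by_contra h
    push Not at h
    have : X = univ := by ext v; simp [h v]
    rw [this, Finset.card_univ] at hX
    omega
  obtain ⟨v0, hv0⟩ := hne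
  have : Nonempty {v | v ∉ X} := ⟨⟨v0, hv0⟩⟩
  refine SimpleGraph.Connected.mk ?_
  by_contra hpre
  unfold SimpleGraph.Preconnected at hpre
  push Not at hpre
  obtain ⟨a, b, hab⟩ := hpre
  set H := G.induce {v | v ∉ X} with hH
  set A : V → Bool := fun v => decide (∃ h : v ∉ X, H.Reachable a ⟨v, h⟩) with hAdef
  set B : V → Bool := fun v => decide (∃ h : v ∉ X, ¬H.Reachable a ⟨v, h⟩) with hBdef
  have hA : A a = true := by simp only [hAdef, decide_eq_true_eq]; exact ⟨a.2, .rfl⟩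
  have hB : B b = true := by simp only [hBdef, decide_eq_true_eq]; exact ⟨b.2, hab⟩
  have hXA : ∀ x ∈ X, A x = false := fun x hx => by simp [hAdef, hx]
  have hXB : ∀ x ∈ X, B x = false := fun x hx => by simp [hBdef, hx]
  have hcov : ∀ v, A v = true ∨ B v = true ∨ v ∈ X := by
    intro v
    by_cases hv : v ∈ X
    · exact Or.inr (Or.inr hv)
    · by_cases hr : H.Reachable a ⟨v, hv⟩
      · left; simp only [hAdef, decide_eq_true_eq]; exact ⟨hv, hr⟩
      · right; left; simp only [hBdef, decide_eq_true_eq]; exact ⟨hv, hr⟩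
  have hdis : ∀ v, A v = true → B v = false := by
    intro v hv
    simp only [hAdef, decide_eq_true_eq] at hv
    simp only [hBdef, decide_eq_false_iff_not]
    rintro ⟨h, h'⟩
    exact h' hv.2
  have hAB : ∀ u v, A u = true → B v = true → ¬G.Adj u v := by
    intro u v hu hv huv
    simp only [hAdef, decide_eq_true_eq] at hu
    simp only [hBdef, decide_eq_true_eq] at hv
    obtain ⟨h1, h2⟩ := hu
    obtain ⟨h3, h4⟩ := hv
    exact h4 (h2.trans (SimpleGraph.Adj.reachable (G := H) (by simpa [hH] using huv)))
  have hcutle : ∀ P Q : V → Bool, (∀ v, P v = true ∨ Q v = true ∨ v ∈ X) →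
      (∀ u v, P u = true → Q v = true → ¬G.Adj u v) →
      cut (wt G) P ≤ ∑ x ∈ X, ∑ v, if P v then wt G x v else 0 := by
    intro P Q hcv hPQ
    rw [Finset.sum_comm]
    refine Finset.sum_le_sum fun u _ => ?_
    rw [← Finset.sum_filter_add_sum_filter_not univ (fun v => v ∈ X)]
    have h0 : (∑ v ∈ univ.filter (fun v => v ∉ X), if P u && !P v then wt G u v else 0) = 0 := by
      refine Finset.sum_eq_zero fun v hv => ?_
      have hv : v ∉ X := by simpa using hv
      by_cases hPu : P u = true
      · rcases hcv v with h | h | h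
        · simp [h]
        · simp [wt_of_not_adj (hPQ u v hPu h)]
        · exact absurd h hv
      · simp [hPu]
    rw [h0, add_zero, Finset.filter_mem_eq_inter, Finset.univ_inter]
    refine Finset.sum_le_sum fun v _ => ?_
    rw [wt_comm G u v]
    cases P u <;> cases P v <;> simp
  have cA := hG.three_le_cut A ⟨a, hA⟩ ⟨b, by
    by_contra h; simp [hdis b (by simpa using h)] at hB⟩
  have cB := hG.three_le_cut B ⟨b, hB⟩ ⟨a, hdis a hA⟩
  have lA := hcutle A B hcov hAB
  have lB := hcutle B A (fun v => by have := hcov v; tauto)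
    (fun u v hu hv h => hAB v u hv hu h.symm)
  have hx3 : ∀ x, (∑ v, if A v then wt G x v else 0) + (∑ v, if B v then wt G x v else 0) ≤ 3 := by
    intro x
    rw [← hG.deg_eq x, deg, ← Finset.sum_add_distrib]
    refine Finset.sum_le_sum fun v _ => ?_
    have := hdis v
    clear_value A B
    cases hAv : A v <;> cases hBv : B v <;> simp [hAv, hBv] at this ⊢
  have hc2 : X.card = 2 := by
    have : ∑ x ∈ X, ((∑ v, if A v then wt G x v else 0) + (∑ v, if B v then wt G x v else 0)) ≤
        X.card * 3 := by
      rw [← smul_eq_mul, ← Finset.sum_const]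
      exact Finset.sum_le_sum fun x _ => hx3 x
    rw [Finset.sum_add_distrib] at this
    omega
  obtain ⟨x, y, hxy, rfl⟩ := Finset.card_eq_two.1 hc2
  rw [Finset.sum_pair hxy] at lA lB
  have hcov' : ∀ v, A v = true ∨ B v = true ∨ v = x ∨ v = y := by
    intro v; have := hcov v; simpa using this
  by_cases h2 : 2 ≤ ∑ v, if A v then wt G x v else 0
  · exact not_separated_by_pair hG hxy ⟨a, hA⟩ ⟨b, hB⟩ hcov' hAB hdis (hXA x (by simp))
      (hXA y (by simp)) (hXB x (by simp)) (hXB y (by simp)) h2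
  · refine not_separated_by_pair hG hxy.symm ⟨a, hA⟩ ⟨b, hB⟩
      (fun v => by have := hcov' v; tauto) hAB hdis (hXA y (by simp))
      (hXA x (by simp)) (hXB y (by simp)) (hXB x (by simp)) (by omega)

/-- The underlying simple graph of a multigraph. -/
def ofWt {V : Type u} (w : V → V → ℕ) (hw : ∀ u v, w u v = w v u) : SimpleGraph V where
  Adj u v := u ≠ v ∧ w u v ≠ 0
  symm := ⟨fun u v h => ⟨h.1.symm, by rw [hw]; exact h.2⟩⟩
  loopless := ⟨fun _ h => h.1 rfl⟩

/-- At most two edges leave the ends of a double edge, so a third vertex would contradict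
3-edge-connectivity. Hence the multigraph is simple. -/
theorem IsCubicMultigraph.wt_ofWt {w : V → V → ℕ} (hw : IsCubicMultigraph w)
    (hcard : 2 < Fintype.card V) : wt (ofWt w hw.symm) = w := by
  classical
  ext u v
  rcases eq_or_ne u v with rfl | huv
  · rw [hw.diag, wt_self]
  have hle : w u v ≤ 1 := by
    by_contra hgt
    have hne : ∃ x, x ≠ u ∧ x ≠ v := by
      by_contra h
      push Not at h
      have : (univ : Finset V) ⊆ {u, v} := fun x _ => by
        by_cases hx : x = u
        · simp [hx]
        · simp [h x hx]
      have := (Finset.card_le_card this).trans Finset.card_le_two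
      rw [Finset.card_univ] at this
      omega
    obtain ⟨x, hxu, hxv⟩ := hne
    have h3 := hw.three_le_cut (fun y => decide (y = u ∨ y = v)) ⟨u, by simp⟩ ⟨x, by simp [hxu, hxv]⟩
    have hrow : ∀ a b, a ≠ b → 2 ≤ w a b →
        (∑ y, if decide (y = a ∨ y = b) then 0 else w a y) ≤ 1 := by
      intro a b hab h2
      have h := hw.deg_eq a
      have : (∑ y, if decide (y = a ∨ y = b) then 0 else w a y) + w a b ≤ deg w a := by
        have e : w a b = ∑ y, if y = b then w a y else 0 := by simp
        rw [e, ← Finset.sum_add_distrib, deg]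
        refine Finset.sum_le_sum fun y _ => ?_
        by_cases h1 : y = a <;> by_cases h2 : y = b <;> simp [h1, h2, hab]
      omega
    have hcut : cut w (fun y => decide (y = u ∨ y = v)) =
        (∑ y, if decide (y = u ∨ y = v) then 0 else w u y) +
        (∑ y, if decide (y = v ∨ y = u) then 0 else w v y) := by
      unfold cut
      rw [← Finset.sum_subset (Finset.subset_univ {u, v}), Finset.sum_pair huv]
      · congr 1 <;> refine Finset.sum_congr rfl fun y _ => ?_
        · by_cases h1 : y = u <;> by_cases h2 : y = v <;> simp [h1, h2]
        · by_cases h1 : y = u <;> by_cases h2 : y = v <;> simp [h1, h2]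
      · intro y _ hy
        simp only [Finset.mem_insert, Finset.mem_singleton] at hy
        simp [hy]
    have r1 := hrow u v huv (by omega)
    have r2 := hrow v u huv.symm (by rw [hw.symm]; omega)
    omega
  unfold wt
  by_cases h0 : w u v = 0
  · simp [ofWt, h0]
  · have : w u v = 1 := by omega
    simp [ofWt, huv, this]

end Weights

/-! ### 3-decompositions as good trees, and critical graphs -/

section GoodTree
open Finset

variable {V : Type u} [Fintype V]

/-- A spanning tree whose cotree edges join vertices of equal tree degree. In a cubic graph these
are the trees of 3-decompositions. -/
structure IsGoodTree (G T : SimpleGraph V) : Prop where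
  le : T ≤ G
  tree : T.IsTree
  deg_eq : ∀ u v, G.Adj u v → ¬T.Adj u v → deg (wt T) u = deg (wt T) v

theorem deg_wt_eq_ncard (G : SimpleGraph V) (v : V) : deg (wt G) v = (G.neighborSet v).ncard := by
  classical
  rw [deg_wt, ← SimpleGraph.card_neighborSet_eq_degree, ← Nat.card_eq_fintype_card]
  rfl

theorem deg_pos {T : SimpleGraph V} (hT : T.Connected) {u v : V} (huv : u ≠ v) :
    1 ≤ deg (wt T) u := by
  classical
  have : Nontrivial V := ⟨u, v, huv⟩
  rw [deg_wt]
  exact hT.preconnected.degree_pos_of_nontrivial u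

theorem sum_deg_of_isTree {T : SimpleGraph V} (hT : T.IsTree) :
    ∑ v, deg (wt T) v + 2 = 2 * Fintype.card V := by
  classical
  have h := (SimpleGraph.isTree_iff_connected_and_card.1 hT).2
  simp only [deg_wt, SimpleGraph.sum_degrees_eq_twice_card_edges]
  rw [Nat.card_eq_fintype_card, Nat.card_eq_fintype_card, SimpleGraph.card_edgeSet] at h
  omega

theorem isTree_of_sum_deg {T : SimpleGraph V} (hT : T.Connected)
    (hs : ∑ v, deg (wt T) v + 2 = 2 * Fintype.card V) : T.IsTree := by
  classical
  refine SimpleGraph.isTree_iff_connected_and_card.2 ⟨hT, ?_⟩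
  simp only [deg_wt, SimpleGraph.sum_degrees_eq_twice_card_edges] at hs
  rw [Nat.card_eq_fintype_card, Nat.card_eq_fintype_card, SimpleGraph.card_edgeSet]
  omega

theorem deg_add_deg_sdiff {G T : SimpleGraph V} (h : T ≤ G) (v : V) :
    deg (wt G) v = deg (wt T) v + deg (wt (G \ T)) v := by
  rw [deg, deg, deg, ← Finset.sum_add_distrib]
  refine Finset.sum_congr rfl fun x _ => ?_
  by_cases h1 : T.Adj v x
  · simp [wt, h1, h h1]
  · by_cases h2 : G.Adj v x <;> simp [wt, h1, h2]

theorem exists_isGoodTree {G : SimpleGraph V} (hG : IsCubicMultigraph (wt G))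
    (h : HasThreeDecomposition G) : ∃ T, IsGoodTree G T := by
  classical
  obtain ⟨T, C, M, hd⟩ := h
  have hadj : ∀ u v, G.Adj u v ↔ T.Adj u v ∨ C.Adj u v ∨ M.Adj u v := by
    intro u v
    have := Set.ext_iff.1 hd.cover s(u, v)
    simp only [Set.mem_union, SimpleGraph.Subgraph.mem_edgeSet, SimpleGraph.mem_edgeSet] at this
    tauto
  have hTC : ∀ u v, T.Adj u v → ¬C.Adj u v := fun u v h1 h2 =>
    Set.disjoint_left.1 hd.disjoint_TC (show s(u, v) ∈ _ by simpa using h1) (by simpa using h2)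
  have hTM : ∀ u v, T.Adj u v → ¬M.Adj u v := fun u v h1 h2 =>
    Set.disjoint_left.1 hd.disjoint_TM (show s(u, v) ∈ _ by simpa using h1) (by simpa using h2)
  have hCM : ∀ u v, C.Adj u v → ¬M.Adj u v := fun u v h1 h2 =>
    Set.disjoint_left.1 hd.disjoint_CM (show s(u, v) ∈ _ by simpa using h1) (by simpa using h2)
  have htree : T.spanningCoe.IsTree :=
    (T.spanningCoeEquivCoeOfSpanning hd.spanning).isTree_iff.2 hd.tree
  have hsum : ∀ v, deg (wt T.spanningCoe) v + deg (wt C.spanningCoe) v +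
      deg (wt M.spanningCoe) v = 3 := by
    intro v
    rw [← hG.deg_eq v, deg, deg, deg, deg, ← Finset.sum_add_distrib, ← Finset.sum_add_distrib]
    refine Finset.sum_congr rfl fun x _ => ?_
    have h1 := hadj v x
    have h2 := hTC v x
    have h3 := hTM v x
    have h4 := hCM v x
    by_cases hT : T.Adj v x <;> by_cases hC : C.Adj v x <;> by_cases hM : M.Adj v x <;>
      simp_all [wt]
  have hC2 : ∀ u v, C.Adj u v → deg (wt C.spanningCoe) u = 2 := fun u v h => by
    rw [deg_wt_eq_ncard]; exact hd.two_regular u h.fst_mem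
  have hC : ∀ u, deg (wt C.spanningCoe) u = 2 ∨ deg (wt C.spanningCoe) u = 0 := fun u => by
    by_cases h : ∃ v, C.Adj u v
    · exact Or.inl (hC2 u _ h.choose_spec)
    · push Not at h
      right
      exact Finset.sum_eq_zero fun v _ => wt_of_not_adj (h v)
  have hM1 : ∀ u v, M.Adj u v → deg (wt M.spanningCoe) u = 1 := fun u v h => by
    obtain ⟨w, _, hw2⟩ := hd.matching h.fst_mem
    rw [deg_wt_eq_ncard, Set.ncard_eq_one]
    refine ⟨v, Set.ext fun x => ?_⟩
    simp only [SimpleGraph.mem_neighborSet, SimpleGraph.Subgraph.spanningCoe_adj,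
      Set.mem_singleton_iff]
    exact ⟨fun hx => (hw2 x hx).trans (hw2 v h).symm, fun hx => hx ▸ h⟩
  refine ⟨T.spanningCoe, T.spanningCoe_le, htree, fun u v huv hT => ?_⟩
  have hu := hsum u
  have hv := hsum v
  have pu := deg_pos htree.connected huv.ne
  have pv := deg_pos htree.connected huv.ne'
  rcases (hadj u v).1 huv with h | h | h
  · exact absurd h hT
  · have := hC2 u v h
    have := hC2 v u h.symm
    omega
  -- At a matched vertex `C` can only have degree 0, as degree 2 would leave no edge for the tree.
  · have := hM1 u v h
    have := hM1 v u h.symm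
    have := hC u
    have := hC v
    omega

theorem IsGoodTree.hasThreeDecomposition {G T : SimpleGraph V} (hG : IsCubicMultigraph (wt G))
    (h : IsGoodTree G T) : HasThreeDecomposition G := by
  classical
  -- Vertices of tree degree `d` have cotree degree `3 - d`: `P 1` is the 2-regular part and `P 2`
  -- the matching.
  let P (d : ℕ) : G.Subgraph :=
    { verts := {v | deg (wt T) v = d}
      Adj := fun u v => G.Adj u v ∧ ¬T.Adj u v ∧ deg (wt T) u = d
      adj_sub := fun h => h.1
      edge_vert := fun h => h.2.2
      symm := ⟨fun u v ⟨h1, h2, h3⟩ =>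
        ⟨h1.symm, fun h' => h2 h'.symm, (h.deg_eq u v h1 h2).symm.trans h3⟩⟩ }
  have hcount : ∀ d v, deg (wt T) v = d → ((P d).neighborSet v).ncard = 3 - d := by
    intro d v hv
    have h1 := deg_add_deg_sdiff h.le v
    rw [hG.deg_eq] at h1
    have : (P d).neighborSet v = (G \ T).neighborSet v := by
      ext x; simp [P, hv]
    rw [this, ← deg_wt_eq_ncard]
    omega
  have hcot : ∀ u v, G.Adj u v → ¬T.Adj u v → deg (wt T) u = 1 ∨ deg (wt T) u = 2 := by
    intro u v huv hT
    have h1 := deg_add_deg_sdiff h.le u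
    rw [hG.deg_eq] at h1
    have h2 := deg_pos h.tree.connected huv.ne
    have h3 : 1 ≤ deg (wt (G \ T)) u := by
      refine le_trans ?_ (Finset.single_le_sum (fun _ _ => Nat.zero_le _) (Finset.mem_univ v))
      rw [wt_of_adj]
      exact ⟨huv, hT⟩
    omega
  refine ⟨SimpleGraph.toSubgraph T h.le, P 1, P 2, ?_⟩
  refine ⟨SimpleGraph.toSubgraph.isSpanning T h.le, ?_, fun v hv => hcount 1 v hv, ?_, ?_, ?_, ?_, ?_⟩
  · have hs := SimpleGraph.toSubgraph.isSpanning T h.le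
    rw [← ((SimpleGraph.toSubgraph T h.le).spanningCoeEquivCoeOfSpanning hs).isTree_iff]
    exact h.tree
  · intro v hv
    have := hcount 2 v hv
    obtain ⟨w, hw⟩ := Set.ncard_eq_one.1 this
    have hw' : ∀ x, (P 2).Adj v x ↔ x = w := fun x => Set.ext_iff.1 hw x
    exact ⟨w, (hw' w).2 rfl, fun y hy => (hw' y).1 hy⟩
  · ext e
    induction e with
    | _ u v =>
    simp only [Set.mem_union, SimpleGraph.Subgraph.mem_edgeSet, SimpleGraph.mem_edgeSet]
    constructor
    · rintro ((h1 | h1) | h1)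
      · exact h.le h1
      · exact h1.1
      · exact h1.1
    · intro huv
      by_cases hT : T.Adj u v
      · exact Or.inl (Or.inl hT)
      · rcases hcot u v huv hT with h1 | h1
        · exact Or.inl (Or.inr ⟨huv, hT, h1⟩)
        · exact Or.inr ⟨huv, hT, h1⟩
  · refine Set.disjoint_left.2 fun e => e.ind fun u v h1 h2 => ?_
    exact (show (P 1).Adj u v from h2).2.1 h1
  · refine Set.disjoint_left.2 fun e => e.ind fun u v h1 h2 => ?_
    exact (show (P 2).Adj u v from h2).2.1 h1
  · refine Set.disjoint_left.2 fun e => e.ind fun u v h1 h2 => ?_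
    have h3 := (show (P 1).Adj u v from h1).2.2
    have h4 := (show (P 2).Adj u v from h2).2.2
    omega

/-- A 3-connected cubic graph without a good tree, all of whose smaller fellows have one. -/
structure IsCritical (G : SimpleGraph V) : Prop where
  cubic : IsCubicMultigraph (wt G)
  no_tree : ∀ T, ¬IsGoodTree G T
  exists_tree : ∀ (W : Type u) [Fintype W] (w : W → W → ℕ) (hw : IsCubicMultigraph w),
    2 < Fintype.card W → Fintype.card W < Fintype.card V → ∃ T, IsGoodTree (ofWt w hw.symm) T

/-- Minimality extends to multigraphs at no cost, because with more than two vertices they are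
simple, and 3-edge-connectivity makes them 3-connected. -/
theorem IsMinimumCounterexample.isCritical {G : SimpleGraph V} [DecidableRel G.Adj]
    (hG : IsMinimumCounterexample G) : IsCritical G := by
  classical
  have hc := isCubicMultigraph_wt hG.cubic hG.threeConnected
  refine ⟨hc, fun T hT => hG.counterexample (hT.hasThreeDecomposition hc), ?_⟩
  intro W _ w hw h2 hlt
  have hw' : IsCubicMultigraph (wt (ofWt w hw.symm)) := by rw [hw.wt_ofWt h2]; exact hw
  have : Nonempty W := Fintype.card_pos_iff.1 (by omega)
  refine exists_isGoodTree hw' (hG.minimum W _ hlt (fun v => ?_) (isKConnected_three hw'))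
  rw [← deg_wt, hw'.deg_eq]

theorem wt_comap {V W : Type u} (G : SimpleGraph V) (e : W ≃ V) (u v : W) :
    wt (G.comap e) u v = wt G (e u) (e v) := by
  by_cases h : G.Adj (e u) (e v) <;> simp [wt, h]

theorem deg_comap {W : Type u} [Fintype W] (G : SimpleGraph V) (e : W ≃ V) (u : W) :
    deg (wt (G.comap e)) u = deg (wt G) (e u) := by
  simp only [deg, wt_comap]
  exact Equiv.sum_comp e (fun x => wt G (e u) x)

theorem cut_comap {W : Type u} [Fintype W] (G : SimpleGraph V) (e : W ≃ V) (z : W → Bool) :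
    cut (wt (G.comap e)) z = cut (wt G) (fun v => z (e.symm v)) := by
  simp only [cut, wt_comap]
  rw [← Equiv.sum_comp e]
  refine Finset.sum_congr rfl fun u _ => ?_
  rw [← Equiv.sum_comp e]
  simp

theorem IsCritical.comap {W : Type u} [Fintype W] {G : SimpleGraph V} (hG : IsCritical G)
    (e : W ≃ V) : IsCritical (G.comap e) := by
  refine ⟨⟨wt_comm _, wt_self _, fun v => ?_, fun z ⟨a, ha⟩ ⟨b, hb⟩ => ?_⟩, fun T hT => ?_, ?_⟩
  · rw [deg_comap, hG.cubic.deg_eq]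
  · rw [cut_comap]
    exact hG.cubic.three_le_cut _ ⟨e a, by simpa using ha⟩ ⟨e b, by simpa using hb⟩
  · refine hG.no_tree (T.comap e.symm) ⟨?_, ?_, ?_⟩
    · intro u v h
      simpa using hT.le h
    · exact (SimpleGraph.Iso.comap e.symm T).isTree_iff.2 hT.tree
    · intro u v huv hn
      rw [deg_comap, deg_comap]
      exact hT.deg_eq _ _ (by simpa using huv) hn
  · intro X _ w hw h2 hlt
    exact hG.exists_tree X w hw h2 (by rwa [← Fintype.card_congr e])

end GoodTree

/-! ### Gluing an outer graph and an inner piece along half-edges -/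

section Glue
open Finset

variable {O : Type u} {n k : ℕ}

/-- The multiplicity of `ab` in a list of edges. -/
def listWt (E : List (Fin n × Fin n)) (a b : Fin n) : ℕ :=
  E.countP fun e => (e.1 == a && e.2 == b) || (e.1 == b && e.2 == a)

/-- The number of edges of a list at the vertex `a`. -/
def listDeg (E : List (Fin n × Fin n)) (a : Fin n) : ℕ :=
  E.countP fun e => Nat.beq e.1.1 a.1 || Nat.beq e.2.1 a.1

/-- The number of half-edges at `a` that belong to `τ`. -/
def halfDeg (τ : Fin k → Bool) (s : Fin k → Fin n) (a : Fin n) : ℕ :=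
  (List.finRange k).countP fun i => τ i && Nat.beq (s i).1 a.1

/-- The degree of `a` with respect to the edges `E` and the half-edges in `τ`. -/
def pieceDeg (E : List (Fin n × Fin n)) (τ : Fin k → Bool) (s : Fin k → Fin n) (a : Fin n) : ℕ :=
  listDeg E a + halfDeg τ s a

/-- Labels of the connected components of the graph with edges `E`. -/
def comps : List (Fin n × Fin n) → List ℕ
  | [] => List.range n
  | e :: E =>
    let l := comps E
    l.map fun x => bif Nat.beq x (l.getD e.2.1 0) then l.getD e.1.1 0 else x

/-- The label of the connected component of `a`. -/
def comp (E : List (Fin n × Fin n)) (a : Fin n) : ℕ := (comps E).getD a.1 0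

open Classical in
/-- The number of half-edges in `τ` whose end is `x`. -/
noncomputable def halves {X : Type*} (τ : Fin k → Bool) (o : Fin k → X) (x : X) : ℕ :=
  ∑ i, if τ i = true ∧ o i = x then 1 else 0

open Classical in
/-- The multigraph that arises from an outer graph `K` and an inner graph `H` by joining `o i` and
`s i` for the half-edges `i` in `τ`. -/
noncomputable def glueWt (K : O → O → ℕ) (H : Fin n → Fin n → ℕ) (τ : Fin k → Bool)
    (o : Fin k → O) (s : Fin k → Fin n) : O ⊕ Fin n → O ⊕ Fin n → ℕ
  | .inl u, .inl v => K u v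
  | .inl u, .inr a => ∑ i, if τ i = true ∧ o i = u ∧ s i = a then 1 else 0
  | .inr a, .inl u => ∑ i, if τ i = true ∧ o i = u ∧ s i = a then 1 else 0
  | .inr a, .inr b => H a b

theorem listWt_comm (E : List (Fin n × Fin n)) (a b : Fin n) : listWt E a b = listWt E b a := by
  unfold listWt
  congr 1
  ext e
  rw [Bool.or_comm]

theorem listWt_self {E : List (Fin n × Fin n)} (hE : ∀ e ∈ E, e.1 ≠ e.2) (a : Fin n) :
    listWt E a a = 0 := by
  unfold listWt
  rw [List.countP_eq_zero]
  intro e he h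
  simp only [Bool.or_self, Bool.and_eq_true, beq_iff_eq] at h
  exact hE e he (h.1.trans h.2.symm)

theorem listWt_ne_zero {E : List (Fin n × Fin n)} {a b : Fin n} :
    listWt E a b ≠ 0 ↔ ∃ e ∈ E, (e.1 = a ∧ e.2 = b) ∨ (e.1 = b ∧ e.2 = a) := by
  rw [listWt, ← Nat.pos_iff_ne_zero, List.countP_pos_iff]
  simp

theorem deg_listWt {E : List (Fin n × Fin n)} (hE : ∀ e ∈ E, e.1 ≠ e.2) (a : Fin n) :
    deg (listWt E) a = listDeg E a := by
  induction E with
  | nil => simp [deg, listWt, listDeg]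
  | cons e E ih =>
    have ih := ih fun e he => hE e (List.mem_cons_of_mem _ he)
    have hne := hE e List.mem_cons_self
    unfold deg listDeg listWt at *
    simp only [List.countP_cons, Finset.sum_add_distrib, ih]
    congr 1
    have : (Nat.beq e.1.1 a.1 || Nat.beq e.2.1 a.1) = decide (e.1 = a ∨ e.2 = a) := by
      rw [Bool.eq_iff_iff]; simp [Fin.ext_iff]
    rw [this]
    rcases e with ⟨x, y⟩
    simp only at hne ⊢
    by_cases hx : x = a
    · subst hx
      rw [Finset.sum_eq_single y]
      · simp
      · intro b _ hb
        simp [hb.symm, hne.symm]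
      · simp
    · by_cases hy : y = a
      · subst hy
        rw [Finset.sum_eq_single x]
        · simp
        · intro b _ hb
          simp [hb.symm, hne]
        · simp
      · simp [hx, hy]

theorem sum_listDeg {E : List (Fin n × Fin n)} (hE : ∀ e ∈ E, e.1 ≠ e.2) :
    ∑ a, listDeg E a = 2 * E.length := by
  induction E with
  | nil => simp [listDeg]
  | cons e E ih =>
    have ih := ih fun e he => hE e (List.mem_cons_of_mem _ he)
    have hne := hE e List.mem_cons_self
    unfold listDeg at *
    simp only [List.countP_cons, Finset.sum_add_distrib, ih, List.length_cons]
    have : ∀ a : Fin n, (if (Nat.beq e.1.1 a.1 || Nat.beq e.2.1 a.1) = true then 1 else 0) =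
        (if e.1 = a then 1 else 0) + (if e.2 = a then 1 else 0) := by
      intro a
      have q : ∀ x : Fin n, Nat.beq x.1 a.1 = decide (x = a) := fun x => by
        rw [Bool.eq_iff_iff]; simp [Fin.ext_iff]
      rw [q, q]
      by_cases h1 : e.1 = a <;> by_cases h2 : e.2 = a
      · exact absurd (h1.trans h2.symm) hne
      all_goals simp [h1, h2]
    simp only [this, Finset.sum_add_distrib, Finset.sum_ite_eq, Finset.mem_univ, if_true]
    omega

theorem halfDeg_eq (τ : Fin k → Bool) (s : Fin k → Fin n) (a : Fin n) :
    halfDeg τ s a = halves τ s a := by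
  classical
  unfold halfDeg halves
  refine Eq.trans ?_ ((Finset.card_filter (fun i => τ i = true ∧ s i = a) univ).trans
    (Finset.sum_congr rfl fun i _ => by congr))
  rw [List.countP_eq_length_filter, ← List.toFinset_card_of_nodup ((List.nodup_finRange k).filter _)]
  congr 1
  ext i
  simp [Fin.ext_iff]

theorem sum_halves {X : Type*} [Fintype X] (τ : Fin k → Bool) (o : Fin k → X) :
    ∑ x, halves τ o x = ∑ i, if τ i = true then 1 else 0 := by
  classical
  unfold halves
  rw [Finset.sum_comm]
  refine Finset.sum_congr rfl fun i _ => ?_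
  cases τ i <;> simp

variable [Fintype O]

theorem deg_glueWt_inl (K : O → O → ℕ) (H : Fin n → Fin n → ℕ) (τ : Fin k → Bool)
    (o : Fin k → O) (s : Fin k → Fin n) (u : O) :
    deg (glueWt K H τ o s) (.inl u) = deg K u + halves τ o u := by
  classical
  simp only [deg, Fintype.sum_sum_type, glueWt, halves]
  congr 1
  rw [Finset.sum_comm]
  refine Finset.sum_congr rfl fun i _ => ?_
  by_cases h : τ i = true ∧ o i = u
  · simp [h.1, h.2]
  · rw [if_neg h]
    refine Finset.sum_eq_zero fun a _ => if_neg fun h' => h ⟨h'.1, h'.2.1⟩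

theorem deg_glueWt_inr (K : O → O → ℕ) (H : Fin n → Fin n → ℕ) (τ : Fin k → Bool)
    (o : Fin k → O) (s : Fin k → Fin n) (a : Fin n) :
    deg (glueWt K H τ o s) (.inr a) = deg H a + halves τ s a := by
  classical
  simp only [deg, Fintype.sum_sum_type, glueWt, halves]
  rw [add_comm]
  congr 1
  rw [Finset.sum_comm]
  refine Finset.sum_congr rfl fun i _ => ?_
  by_cases h : τ i = true ∧ s i = a
  · simp [h.1, h.2]
  · rw [if_neg h]
    refine Finset.sum_eq_zero fun a _ => if_neg fun h' => h ⟨h'.1, h'.2.2⟩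

theorem deg_glueWt_list_inr (K : O → O → ℕ) {E : List (Fin n × Fin n)} (hE : ∀ e ∈ E, e.1 ≠ e.2)
    (τ : Fin k → Bool) (o : Fin k → O) (s : Fin k → Fin n) (a : Fin n) :
    deg (glueWt K (listWt E) τ o s) (.inr a) = pieceDeg E τ s a := by
  rw [deg_glueWt_inr, deg_listWt hE, pieceDeg, halfDeg_eq]

theorem cut_glueWt (K : O → O → ℕ) (H : Fin n → Fin n → ℕ) (τ : Fin k → Bool)
    (o : Fin k → O) (s : Fin k → Fin n) (z : O ⊕ Fin n → Bool) :
    cut (glueWt K H τ o s) z = cut K (fun u => z (.inl u)) +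
      (∑ i, if τ i = true ∧ z (.inl (o i)) ≠ z (.inr (s i)) then 1 else 0) +
      cut H (fun a => z (.inr a)) := by
  classical
  have key : ∀ i, (if τ i = true ∧ z (.inl (o i)) ≠ z (.inr (s i)) then 1 else 0) =
      (∑ u, ∑ a, if z (.inl u) && !z (.inr a) then
          (if τ i = true ∧ o i = u ∧ s i = a then 1 else 0) else 0) +
      ∑ a, ∑ u, if z (.inr a) && !z (.inl u) then
          (if τ i = true ∧ o i = u ∧ s i = a then 1 else 0) else 0 := by
    intro i
    have e1 : (∑ u, ∑ a, if z (.inl u) && !z (.inr a) then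
          (if τ i = true ∧ o i = u ∧ s i = a then 1 else 0) else 0) =
        if τ i = true ∧ z (.inl (o i)) = true ∧ z (.inr (s i)) = false then 1 else 0 := by
      rw [Finset.sum_eq_single (o i), Finset.sum_eq_single (s i)]
      · cases τ i <;> cases z (.inl (o i)) <;> cases z (.inr (s i)) <;> simp
      · intro b _ hb; simp [hb.symm]
      · simp
      · intro b _ hb; simp [hb.symm]
      · simp
    have e2 : (∑ a, ∑ u, if z (.inr a) && !z (.inl u) then
          (if τ i = true ∧ o i = u ∧ s i = a then 1 else 0) else 0) =
        if τ i = true ∧ z (.inl (o i)) = false ∧ z (.inr (s i)) = true then 1 else 0 := by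
      rw [Finset.sum_eq_single (s i), Finset.sum_eq_single (o i)]
      · cases τ i <;> cases z (.inl (o i)) <;> cases z (.inr (s i)) <;> simp
      · intro b _ hb; simp [hb.symm]
      · simp
      · intro b _ hb; simp [hb.symm]
      · simp
    rw [e1, e2]
    cases τ i <;> cases z (.inl (o i)) <;> cases z (.inr (s i)) <;> simp
  have e3 : (∑ i, if τ i = true ∧ z (.inl (o i)) ≠ z (.inr (s i)) then 1 else 0) =
      (∑ u, ∑ a, if z (.inl u) && !z (.inr a) then
        (∑ i, if τ i = true ∧ o i = u ∧ s i = a then 1 else 0) else 0) +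
      ∑ a, ∑ u, if z (.inr a) && !z (.inl u) then
        (∑ i, if τ i = true ∧ o i = u ∧ s i = a then 1 else 0) else 0 := by
    simp only [key, Finset.sum_add_distrib]
    congr 1
    all_goals
      rw [Finset.sum_comm]
      refine Finset.sum_congr rfl fun u _ => ?_
      rw [Finset.sum_comm]
      refine Finset.sum_congr rfl fun a _ => ?_
      split_ifs <;> simp
  rw [e3]
  simp only [cut, Fintype.sum_sum_type, glueWt, Finset.sum_add_distrib]
  ring

theorem length_comps (E : List (Fin n × Fin n)) : (comps E).length = n := by
  induction E with
  | nil => simp [comps]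
  | cons e E ih => simp [comps, ih]

theorem comp_cons (e : Fin n × Fin n) (E : List (Fin n × Fin n)) (a : Fin n) :
    comp (e :: E) a = if comp E a = comp E e.2 then comp E e.1 else comp E a := by
  have h : a.1 < (comps E).length := by rw [length_comps]; exact a.2
  have h' : a.1 < (comps (e :: E)).length := by rw [length_comps]; exact a.2
  unfold comp
  rw [List.getD_eq_getElem _ _ h']
  simp only [comps, List.getElem_map]
  rw [← List.getD_eq_getElem _ 0 h]
  by_cases hc : (comps E).getD a.1 0 = (comps E).getD e.2.1 0
  · simp
  · have : Nat.beq ((comps E).getD a.1 0) ((comps E).getD e.2.1 0) = false := by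
      rw [← Bool.not_eq_true, Nat.beq_eq]; exact hc
    rw [this, if_neg hc]; rfl

/-- Inner connectivity is used in this form, without walks: what is invariant along the edges is
invariant on the label classes. -/
theorem comp_sound {E : List (Fin n × Fin n)} {Z : Fin n → Prop}
    (hZ : ∀ e ∈ E, (Z e.1 ↔ Z e.2)) {a b : Fin n} (h : comp E a = comp E b) : Z a ↔ Z b := by
  induction E generalizing a b with
  | nil =>
    have : a = b := by
      apply Fin.ext
      simpa [comp, comps, List.getD_eq_getElem] using h
    rw [this]
  | cons e E ih =>
    have ih := fun a b => @ih (fun e he => hZ e (List.mem_cons_of_mem _ he)) a b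
    have he := hZ e List.mem_cons_self
    rw [comp_cons, comp_cons] at h
    split_ifs at h with h1 h2 h2
    · exact (ih _ _ h1).trans (ih _ _ h2).symm
    · exact (ih _ _ h1).trans (he.symm.trans (ih _ _ h))
    · exact (ih _ _ h).trans (he.trans (ih _ _ h2).symm)
    · exact ih _ _ h

theorem comp_complete {E : List (Fin n × Fin n)} {e : Fin n × Fin n} (he : e ∈ E) :
    comp E e.1 = comp E e.2 := by
  induction E with
  | nil => simp at he
  | cons e' E ih =>
    rw [comp_cons, comp_cons]
    rcases List.mem_cons.1 he with rfl | he
    · simp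
    · rw [ih he]

end Glue

/-! ### Interfaces: splitting a good tree and reassembling it -/

section Exchange
open Finset

variable {O : Type u} {n m k : ℕ}

/-- The half-edges with label `0`, which are those of the tree. -/
def treeHalf (L : Fin k → ℕ) (i : Fin k) : Bool := Nat.beq (L i) 0

theorem treeHalf_iff {L : Fin k → ℕ} {i : Fin k} : treeHalf L i = true ↔ L i = 0 := by
  simp [treeHalf]

theorem treeHalf_eq_false {L : Fin k → ℕ} {i : Fin k} : treeHalf L i = false ↔ L i ≠ 0 := by
  rw [← Bool.not_eq_true, treeHalf_iff]

/-- The degree of an outer vertex in the outer forest `T` together with the half-edges of the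
tree. -/
noncomputable def outerDeg [Fintype O] (T : SimpleGraph O) (o : Fin k → O) (L : Fin k → ℕ)
    (u : O) : ℕ :=
  deg (wt T) u + halves (treeHalf L) o u

/-- The forest `T` is the outer part of a good tree of a graph whose outer part is `K`. The label
`L i` of the half-edge `i` is `0` if it belongs to the tree and the tree degree of its ends
otherwise; the tree halves with the same value of `cl` are joined inside, and the inner part of the
tree has `r` components. -/
structure IsOuter [Fintype O] (K T : SimpleGraph O) (o : Fin k → O) (L cl : Fin k → ℕ) (r : ℕ) :
    Prop where
  le : T ≤ K
  deg_eq : ∀ u v, K.Adj u v → ¬T.Adj u v → outerDeg T o L u = outerDeg T o L v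
  half : ∀ i, L i ≠ 0 → outerDeg T o L (o i) = L i
  sum : ∑ u, outerDeg T o L u + (∑ i, if treeHalf L i = true then 1 else 0) + 2 =
    2 * Fintype.card O + 2 * r
  conn : ∀ Z : O → Prop, (∀ u v, T.Adj u v → Z u → Z v) →
    (∀ i j, L i = 0 → L j = 0 → cl i = cl j → Z (o i) → Z (o j)) → ∀ u v, Z u → Z v

/-- The edges `E` form the inner part of a good tree with the data `L`, `cl`, `r` of `IsOuter`, for
the inner graph with edges `H` and half-edges `s`. -/
structure IsInner (H E : List (Fin n × Fin n)) (s : Fin k → Fin n) (L cl : Fin k → ℕ) (r : ℕ) :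
    Prop where
  sub : E.Sublist H
  deg_eq : ∀ e ∈ H, e ∈ E ∨ pieceDeg E (treeHalf L) s e.1 = pieceDeg E (treeHalf L) s e.2
  half : ∀ i, L i = 0 ∨ pieceDeg E (treeHalf L) s (s i) = L i
  touch : ∀ a, ∃ i, L i = 0 ∧ comp E a = comp E (s i)
  link : ∀ i j, L i = 0 → L j = 0 → cl i = cl j → comp E (s i) = comp E (s j)
  card : E.length + r = n

/-- A test for `IsInner`. -/
def innerCheck (H E : List (Fin n × Fin n)) (s : Fin k → Fin n) (L cl : Fin k → ℕ) (r : ℕ) :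
    Bool :=
  Nat.beq (E.length + r) n &&
  ((List.finRange k).all fun i =>
    Nat.beq (L i) 0 || Nat.beq (pieceDeg E (treeHalf L) s (s i)) (L i)) &&
  (H.all fun e => E.contains e ||
    Nat.beq (pieceDeg E (treeHalf L) s e.1) (pieceDeg E (treeHalf L) s e.2)) &&
  ((List.finRange n).all fun a => (List.finRange k).any fun i =>
    Nat.beq (L i) 0 && Nat.beq (comp E a) (comp E (s i))) &&
  ((List.finRange k).all fun i => (List.finRange k).all fun j =>
    !Nat.beq (L i) 0 || !Nat.beq (L j) 0 || !Nat.beq (cl i) (cl j) ||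
      Nat.beq (comp E (s i)) (comp E (s j))) &&
  E.isSublist H

theorem isInner_of_innerCheck {H E : List (Fin n × Fin n)} {s : Fin k → Fin n} {L cl : Fin k → ℕ}
    {r : ℕ} (h : innerCheck H E s L cl r = true) : IsInner H E s L cl r := by
  simp only [innerCheck, Bool.and_eq_true, List.all_eq_true, List.any_eq_true, Bool.or_eq_true,
    Nat.beq_eq, List.isSublist_iff_sublist, List.mem_finRange, true_implies, true_and,
    List.contains_iff_mem, Bool.not_eq_true', ← Bool.not_eq_true (Nat.beq _ _)] at h
  obtain ⟨⟨⟨⟨⟨h1, h2⟩, h3⟩, h4⟩, h5⟩, h6⟩ := h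
  refine ⟨h6, h3, h2, h4, fun i j hi hj hc => ?_, h1⟩
  have := h5 i j
  tauto

theorem listWt_le {H E : List (Fin n × Fin n)} (h : E.Sublist H) (a b : Fin n) :
    listWt E a b ≤ listWt H a b := h.countP_le

variable [Fintype O]

/-- Join `T`, `E` and the tree half-edges. By `touch` every inner vertex is connected to an outer
one, and by `link` the inside provides the connections that `conn` relies on. Connectivity and the
degree sum obtained from `sum` and `card` give a tree, so acyclicity needs no separate argument. -/
theorem IsInner.exists_isGoodTree {K T : SimpleGraph O} {o : Fin k → O} {L cl : Fin k → ℕ} {r : ℕ}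
    {H E : List (Fin n × Fin n)} {s : Fin k → Fin n} (hE : IsInner H E s L cl r)
    (hT : IsOuter K T o L cl r) (hH : ∀ e ∈ H, e.1 ≠ e.2) {G : SimpleGraph (O ⊕ Fin n)}
    (hG : wt G = glueWt (wt K) (listWt H) (fun _ => true) o s) (hO : Nonempty O) :
    ∃ T', IsGoodTree G T' := by
  classical
  have hE' : ∀ e ∈ E, e.1 ≠ e.2 := fun e he => hH e (hE.sub.subset he)
  set w := glueWt (wt T) (listWt E) (treeHalf L) o s with hw
  have hsymm : ∀ x y, w x y = w y x := by
    rintro (u | a) (v | b)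
    · exact wt_comm T u v
    · rfl
    · rfl
    · exact listWt_comm E a b
  have hle : ∀ x y, w x y ≤ wt G x y := by
    rw [hG]
    rintro (u | a) (v | b)
    · show wt T u v ≤ wt K u v
      by_cases h : T.Adj u v
      · rw [wt_of_adj h, wt_of_adj (hT.le h)]
      · rw [wt_of_not_adj h]; exact Nat.zero_le _
    · refine Finset.sum_le_sum fun i _ => ?_
      split_ifs with h1 h2 <;> simp_all
    · refine Finset.sum_le_sum fun i _ => ?_
      split_ifs with h1 h2 <;> simp_all
    · exact listWt_le hE.sub a b
  have hdiag : ∀ x, w x x = 0 := fun x => Nat.le_zero.1 ((hle x x).trans (wt_self G x).le)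
  have hadj : ∀ x y, (ofWt w hsymm).Adj x y ↔ w x y ≠ 0 := fun x y =>
    ⟨fun h => h.2, fun h => ⟨fun hxy => h (hxy ▸ hdiag x), h⟩⟩
  have hwt : wt (ofWt w hsymm) = w := by
    ext x y
    have h1 := (hle x y).trans (wt_le_one G x y)
    by_cases h : w x y = 0
    · rw [h]; exact wt_of_not_adj fun h' => (hadj x y).1 h' h
    · rw [wt_of_adj ((hadj x y).2 h)]; omega
  have hdl : ∀ u, deg w (.inl u) = outerDeg T o L u := fun u => deg_glueWt_inl _ _ _ _ _ u
  have hdr : ∀ a, deg w (.inr a) = pieceDeg E (treeHalf L) s a := fun a =>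
    deg_glueWt_list_inr _ hE' _ _ _ a
  have hhalf : ∀ i, L i = 0 → (ofWt w hsymm).Adj (.inl (o i)) (.inr (s i)) := by
    intro i hi
    rw [hadj]
    show (∑ j, _) ≠ 0
    rw [← Nat.pos_iff_ne_zero]
    exact Finset.sum_pos' (fun _ _ => Nat.zero_le _) ⟨i, Finset.mem_univ _, by simp [treeHalf_iff, hi]⟩
  have hconn : ∀ Z : O ⊕ Fin n → Prop, (∀ x y, (ofWt w hsymm).Adj x y → Z x → Z y) →
      ∀ x y, Z x → Z y := by
    intro Z hZ
    have hin : ∀ a b, comp E a = comp E b → (Z (.inr a) ↔ Z (.inr b)) := by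
      intro a b hab
      refine comp_sound (Z := fun a => Z (.inr a)) (fun e he => ?_) hab
      have : (ofWt w hsymm).Adj (.inr e.1) (.inr e.2) := by
        rw [hadj]; exact listWt_ne_zero.2 ⟨e, he, Or.inl ⟨rfl, rfl⟩⟩
      exact ⟨hZ _ _ this, hZ _ _ this.symm⟩
    have hou := hT.conn (fun u => Z (.inl u)) (fun u v huv => hZ _ _ (by
        rw [hadj]; show wt T u v ≠ 0; exact wt_ne_zero.2 huv))
      (fun i j hi hj hc h => hZ _ _ (hhalf j hj).symm
        ((hin _ _ (hE.link i j hi hj hc)).1 (hZ _ _ (hhalf i hi) h)))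
    have hre : ∀ x, ∃ u, (Z x ↔ Z (.inl u)) := by
      rintro (u | a)
      · exact ⟨u, Iff.rfl⟩
      · obtain ⟨i, hi, hc⟩ := hE.touch a
        exact ⟨o i, (hin _ _ hc).trans ⟨hZ _ _ (hhalf i hi).symm, hZ _ _ (hhalf i hi)⟩⟩
    intro x y hx
    obtain ⟨u, hu⟩ := hre x
    obtain ⟨v, hv⟩ := hre y
    exact hv.2 (hou u v (hu.1 hx))
  have : Nonempty (O ⊕ Fin n) := ⟨.inl hO.some⟩
  have hc : (ofWt w hsymm).Connected := SimpleGraph.Connected.mk fun x y =>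
    hconn (fun y => (ofWt w hsymm).Reachable x y)
      (fun _ _ h h' => h'.trans h.reachable) x y SimpleGraph.Reachable.rfl
  refine ⟨ofWt w hsymm, fun x y h => ?_, isTree_of_sum_deg hc ?_, ?_⟩
  · have h1 := hle x y
    rw [hadj] at h
    exact wt_ne_zero.1 (by omega)
  · have h1 := hT.sum
    have h2 := hE.card
    have h3 : ∑ a, pieceDeg E (treeHalf L) s a = 2 * E.length +
        ∑ i, if treeHalf L i = true then 1 else 0 := by
      simp only [pieceDeg, Finset.sum_add_distrib, sum_listDeg hE', halfDeg_eq, sum_halves]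
    rw [hwt, Fintype.sum_sum_type, Fintype.card_sum, Fintype.card_fin]
    simp only [hdl, hdr, h3]
    omega
  · have hside : ∀ u a, G.Adj (.inl u) (.inr a) → ¬(ofWt w hsymm).Adj (.inl u) (.inr a) →
        outerDeg T o L u = pieceDeg E (treeHalf L) s a := by
      intro u a h1 h2
      have h1 := wt_ne_zero.2 h1
      rw [hG] at h1
      obtain ⟨i, _, hi⟩ := Finset.exists_ne_zero_of_sum_ne_zero h1
      have hi' : o i = u ∧ s i = a := by
        by_contra hcon
        exact hi (if_neg fun h => hcon h.2)
      obtain ⟨rfl, rfl⟩ := hi'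
      have hL : L i ≠ 0 := fun hL => h2 (hhalf i hL)
      rw [hT.half i hL, (hE.half i).resolve_left hL]
    rw [hwt]
    rintro (u | a) (v | b) h1 h2
    · rw [hdl, hdl]
      refine hT.deg_eq u v ?_ fun h => h2 ?_
      · have := wt_ne_zero.2 h1
        rw [hG] at this
        exact wt_ne_zero.1 this
      · rw [hadj]; exact wt_ne_zero.2 h
    · rw [hdl, hdr]; exact hside u b h1 h2
    · rw [hdl, hdr]; exact (hside v a h1.symm fun h => h2 h.symm).symm
    · rw [hdr, hdr]
      have h1 := wt_ne_zero.2 h1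
      rw [hG] at h1
      obtain ⟨e, he, hab⟩ := listWt_ne_zero.1 h1
      have hne : e ∉ E := fun he' => h2 ((hadj _ _).2 (listWt_ne_zero.2 ⟨e, he', hab⟩))
      have := (hE.deg_eq e he).resolve_left hne
      rcases hab with ⟨rfl, rfl⟩ | ⟨rfl, rfl⟩
      · exact this
      · exact this.symm

/-- The label of a half-edge that is determined by the inner part of a good tree. -/
def innerLabel (E : List (Fin m × Fin m)) (τ : Fin k → Bool) (t : Fin k → Fin m) (i : Fin k) : ℕ :=
  bif τ i then 0 else pieceDeg E τ t (t i)

/-- Necessary conditions on the inner edges `E` and the half-edges `τ` of a good tree, for the inner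
graph with edges `H` and half-edges `t`. -/
structure IsTrace (H E : List (Fin m × Fin m)) (t : Fin k → Fin m) (τ : Fin k → Bool) : Prop where
  sub : E.Sublist H
  deg_eq : ∀ e ∈ H, e ∈ E ∨ pieceDeg E τ t e.1 = pieceDeg E τ t e.2
  touch : ∀ a, ∃ i, τ i = true ∧ comp E a = comp E (t i)

/-- Subtracting the inner degrees from the degree sum of the tree leaves the equation `sum`, with `m
- E.length` inner components. The bound `hlen` ensures that this subtraction is not truncated. -/
theorem IsGoodTree.exists_trace {K : SimpleGraph O} {o : Fin k → O} {H : List (Fin m × Fin m)}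
    {t : Fin k → Fin m} (hH : ∀ e ∈ H, e.1 ≠ e.2) {G T : SimpleGraph (O ⊕ Fin m)}
    (hG : wt G = glueWt (wt K) (listWt H) (fun _ => true) o t) (hT : IsGoodTree G T)
    (hlen : H.length ≤ m) (hO : Nonempty O) :
    ∃ E τ, IsTrace H E t τ ∧ (∀ e ∈ E, T.Adj (.inr e.1) (.inr e.2)) ∧
      IsOuter K (T.comap Sum.inl) o (innerLabel E τ t) (fun i => comp E (t i)) (m - E.length) := by
  classical
  set E := H.filter fun e => decide (T.Adj (.inr e.1) (.inr e.2)) with hE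
  set τ : Fin k → Bool := fun i => decide (T.Adj (.inl (o i)) (.inr (t i))) with hτ
  have hsub : E.Sublist H := List.filter_sublist
  have hE' : ∀ e ∈ E, e.1 ≠ e.2 := fun e he => hH e (hsub.subset he)
  have hmem : ∀ e, e ∈ E ↔ e ∈ H ∧ T.Adj (.inr e.1) (.inr e.2) := fun e => by simp [hE]
  have hGi : ∀ i, G.Adj (.inl (o i)) (.inr (t i)) := by
    intro i
    rw [← wt_ne_zero, hG, ← Nat.pos_iff_ne_zero]
    exact Finset.sum_pos' (fun _ _ => Nat.zero_le _) ⟨i, Finset.mem_univ _, by simp⟩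
  have hGe : ∀ e ∈ H, G.Adj (.inr e.1) (.inr e.2) := by
    intro e he
    rw [← wt_ne_zero, hG]
    exact listWt_ne_zero.2 ⟨e, he, Or.inl ⟨rfl, rfl⟩⟩
  have hmix : ∀ u a, wt T (.inl u) (.inr a) =
      ∑ i, if τ i = true ∧ o i = u ∧ t i = a then 1 else 0 := by
    intro u a
    by_cases h : T.Adj (.inl u) (.inr a)
    · refine (wt_of_adj h).trans ((wt_of_adj (hT.le h)).symm.trans ?_)
      rw [hG]
      refine Finset.sum_congr rfl fun i _ => ?_
      by_cases hi : o i = u ∧ t i = a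
      · have : τ i = true := by simp [hτ, hi.1, hi.2, h]
        simp [this, hi.1, hi.2]
      · rw [if_neg fun h => hi h.2, if_neg fun h => hi h.2]
    · rw [wt_of_not_adj h, Finset.sum_eq_zero]
      intro i _
      refine if_neg ?_
      rintro ⟨h1, rfl, rfl⟩
      simp [hτ] at h1
      exact h h1
  have hwt : wt T = glueWt (wt (T.comap Sum.inl)) (listWt E) τ o t := by
    ext x y
    rcases x with u | a <;> rcases y with v | b
    · simp only [glueWt]
      by_cases h : T.Adj (.inl u) (.inl v) <;> simp [wt, h]
    · exact hmix u b
    · rw [wt_comm]; exact hmix v a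
    · show _ = listWt E a b
      by_cases h : T.Adj (.inr a) (.inr b)
      · have h1 := wt_of_adj (hT.le h)
        rw [hG] at h1
        rw [wt_of_adj h]
        refine h1.symm.trans ?_
        show H.countP _ = E.countP _
        rw [hE, List.countP_filter]
        refine List.countP_congr fun e he => ?_
        simp only [Bool.or_eq_true, Bool.and_eq_true, beq_iff_eq, decide_eq_true_eq]
        constructor
        · rintro (⟨rfl, rfl⟩ | ⟨rfl, rfl⟩)
          · exact ⟨Or.inl ⟨rfl, rfl⟩, h⟩
          · exact ⟨Or.inr ⟨rfl, rfl⟩, h.symm⟩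
        · exact fun h => h.1
      · rw [wt_of_not_adj h]
        by_contra hne
        obtain ⟨e, he, hab⟩ := listWt_ne_zero.1 (Ne.symm hne)
        have := ((hmem e).1 he).2
        rcases hab with ⟨rfl, rfl⟩ | ⟨rfl, rfl⟩
        · exact h this
        · exact h this.symm
  have hdr : ∀ a, deg (wt T) (.inr a) = pieceDeg E τ t a := fun a => by
    rw [hwt]; exact deg_glueWt_list_inr _ hE' _ _ _ a
  -- Positive tree degrees make the label 0 unambiguous: it occurs at the tree half-edges only.
  have hpos : ∀ a, 1 ≤ pieceDeg E τ t a := fun a => by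
    rw [← hdr]; exact deg_pos hT.tree.connected (v := .inl hO.some) (by simp)
  have hL : treeHalf (innerLabel E τ t) = τ := by
    ext i
    have := hpos (t i)
    cases h : τ i
    · rw [treeHalf_eq_false, innerLabel, h]; simp; omega
    · rw [treeHalf_iff, innerLabel, h]; rfl
  have hL0 : ∀ i, innerLabel E τ t i = 0 ↔ τ i = true := fun i => by
    rw [← treeHalf_iff, hL]
  have hdl : ∀ u, deg (wt T) (.inl u) =
      outerDeg (T.comap Sum.inl) o (innerLabel E τ t) u := fun u => by
    rw [outerDeg, hL]; conv_lhs => rw [hwt]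
    exact deg_glueWt_inl _ _ _ _ _ u
  have hcl : ∀ Z : O ⊕ Fin m → Prop, (∀ x y, T.Adj x y → Z x → Z y) → ∀ x y, Z x → Z y :=
    fun Z hZ x y hx => reachable_induct hZ (hT.tree.connected.preconnected x y) hx
  have hcase : ∀ x y, T.Adj x y → (∃ u v, x = .inl u ∧ y = .inl v) ∨
      (∃ i, τ i = true ∧ x = .inl (o i) ∧ y = .inr (t i)) ∨
      (∃ i, τ i = true ∧ x = .inr (t i) ∧ y = .inl (o i)) ∨
      ∃ a b, x = .inr a ∧ y = .inr b ∧ comp E a = comp E b := by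
    have hh : ∀ u a, T.Adj (.inl u) (.inr a) → ∃ i, τ i = true ∧ u = o i ∧ a = t i := by
      intro u a h
      have h := wt_ne_zero.2 h
      rw [hmix] at h
      obtain ⟨i, _, hi⟩ := Finset.exists_ne_zero_of_sum_ne_zero h
      have hi' : τ i = true ∧ o i = u ∧ t i = a := by
        by_contra hcon; exact hi (if_neg hcon)
      exact ⟨i, hi'.1, hi'.2.1.symm, hi'.2.2.symm⟩
    rintro (u | a) (v | b) h
    · exact Or.inl ⟨u, v, rfl, rfl⟩
    · obtain ⟨i, h1, rfl, rfl⟩ := hh u b h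
      exact Or.inr (Or.inl ⟨i, h1, rfl, rfl⟩)
    · obtain ⟨i, h1, rfl, rfl⟩ := hh v a h.symm
      exact Or.inr (Or.inr (Or.inl ⟨i, h1, rfl, rfl⟩))
    · refine Or.inr (Or.inr (Or.inr ⟨a, b, rfl, rfl, ?_⟩))
      have h := wt_ne_zero.2 h
      rw [hwt] at h
      obtain ⟨e, he, hab⟩ := listWt_ne_zero.1 h
      have := comp_complete he
      rcases hab with ⟨rfl, rfl⟩ | ⟨rfl, rfl⟩
      · exact this
      · exact this.symm
  refine ⟨E, τ, ⟨hsub, fun e he => ?_, fun a => ?_⟩, fun e he => ((hmem e).1 he).2, ?_⟩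
  · by_cases h : e ∈ E
    · exact Or.inl h
    · right
      rw [← hdr, ← hdr]
      exact hT.deg_eq _ _ (hGe e he) fun h' => h ((hmem e).2 ⟨he, h'⟩)
  · by_contra hcon
    push Not at hcon
    -- An inner component without tree half-edges would be closed under tree adjacency and miss the
    -- outer vertices.
    have := hcl (fun x => ∃ b, x = .inr b ∧ comp E b = comp E a) (fun x y hxy => ?_) (.inr a)
      (.inl hO.some) ⟨a, rfl, rfl⟩
    · simp at this
    · rintro ⟨b, rfl, hb⟩
      rcases hcase _ _ hxy with ⟨u, v, h, _⟩ | ⟨i, _, h, _⟩ | ⟨i, hi, h, _⟩ | ⟨c, d, h, rfl, hcd⟩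
      · simp at h
      · simp at h
      · simp only [Sum.inr.injEq] at h
        exact absurd (h ▸ hb.symm) (hcon i hi)
      · simp only [Sum.inr.injEq] at h
        exact ⟨d, rfl, by rw [← hcd, ← h, hb]⟩
  · refine ⟨?_, ?_, ?_, ?_, ?_⟩
    · intro u v h
      have h := wt_ne_zero.2 (hT.le (show T.Adj (.inl u) (.inl v) from h))
      rw [hG] at h
      exact wt_ne_zero.1 h
    · intro u v huv hn
      rw [← hdl, ← hdl]
      refine hT.deg_eq _ _ ?_ hn
      rw [← wt_ne_zero, hG]
      exact wt_ne_zero.2 huv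
    · intro i hi
      have hτi : τ i = false := by
        rw [← Bool.not_eq_true, ← hL0]; exact hi
      rw [← hdl, hT.deg_eq _ _ (hGi i) (by simpa [hτ] using hτi), hdr, innerLabel, hτi]
      rfl
    · have h1 := sum_deg_of_isTree hT.tree
      have h3 : ∑ a, pieceDeg E τ t a = 2 * E.length +
          ∑ i, if τ i = true then 1 else 0 := by
        simp only [pieceDeg, Finset.sum_add_distrib, sum_listDeg hE', halfDeg_eq, sum_halves]
      rw [Fintype.sum_sum_type, Fintype.card_sum, Fintype.card_fin] at h1
      simp only [hdl, hdr, h3] at h1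
      rw [hL]
      have := hsub.length_le
      omega
    · intro Z hZ hlink u v hu
      -- The closed outer set is extended by the inner components that have a tree half-edge ending
      -- in it.
      have := hcl (fun x => match x with
        | .inl u => Z u
        | .inr a => ∃ i, τ i = true ∧ comp E a = comp E (t i) ∧ Z (o i)) (fun x y hxy => ?_)
        (.inl u) (.inl v) hu
      · exact this
      · rcases hcase _ _ hxy with ⟨u, v, rfl, rfl⟩ | ⟨i, hi, rfl, rfl⟩ | ⟨i, hi, rfl, rfl⟩ |
          ⟨c, d, rfl, rfl, hcd⟩
        · exact hZ u v hxy
        · exact fun h => ⟨i, hi, rfl, h⟩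
        · rintro ⟨j, hj, hc, h⟩
          exact hlink j i ((hL0 j).2 hj) ((hL0 i).2 hi) hc.symm h
        · rintro ⟨j, hj, hc, h⟩
          exact ⟨j, hj, hcd ▸ hc, h⟩

end Exchange

/-! ### Finite verification of the replacements -/

section Tables

/-- A test for `IsTrace`. -/
def traceCheck {m k : ℕ} (H E : List (Fin m × Fin m)) (t : Fin k → Fin m) (τ : Fin k → Bool) :
    Bool :=
  (H.all fun e => E.contains e || Nat.beq (pieceDeg E τ t e.1) (pieceDeg E τ t e.2)) &&
  (List.finRange m).all fun a => (List.finRange k).any fun i =>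
    τ i && Nat.beq (comp E a) (comp E (t i))

theorem IsTrace.traceCheck {m k : ℕ} {H E : List (Fin m × Fin m)} {t : Fin k → Fin m}
    {τ : Fin k → Bool} (h : IsTrace H E t τ) : traceCheck H E t τ = true := by
  simp only [ThreeDecomposition.traceCheck, Bool.and_eq_true, List.all_eq_true, List.any_eq_true,
    Bool.or_eq_true, Nat.beq_eq, List.mem_finRange, true_implies, true_and, List.contains_iff_mem]
  exact ⟨h.deg_eq, h.touch⟩

/-- Some forest in the list `F` realizes the trace `E`, `τ` in the inner graph with edges `H` and
half-edges `s`. -/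
def realizable {n m k : ℕ} (H : List (Fin n × Fin n)) (s : Fin k → Fin n)
    (F : List (List (Fin n × Fin n))) (t : Fin k → Fin m) (E : List (Fin m × Fin m))
    (τ : Fin k → Bool) : Bool :=
  F.any fun E' => innerCheck H E' s (innerLabel E τ t) (fun i => comp E (t i)) (m - E.length)

def triangleEdges : List (Fin 3 × Fin 3) := [(0, 1), (1, 2), (0, 2)]

def k23Edges : List (Fin 5 × Fin 5) := [(0, 2), (0, 3), (0, 4), (1, 2), (1, 3), (1, 4)]

def clawSquareEdges : List (Fin 8 × Fin 8) :=
  [(0, 1), (1, 2), (2, 3), (3, 0), (7, 4), (7, 5), (7, 6), (0, 4), (1, 5), (2, 6)]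

def twinHouseEdges : List (Fin 6 × Fin 6) :=
  [(0, 1), (0, 4), (1, 5), (4, 2), (4, 3), (5, 2), (5, 3)]

def dominoEdges : List (Fin 6 × Fin 6) :=
  [(0, 1), (0, 4), (1, 5), (4, 5), (4, 2), (5, 3), (2, 3)]

/-- The edges of the Petersen graph without the vertex `0`, where the vertex `i + 1` is called
`i`. -/
def petersenEdges : List (Fin 9 × Fin 9) :=
  [(0, 1), (1, 2), (2, 3), (0, 5), (1, 6), (2, 7), (3, 8), (4, 6), (6, 8), (8, 5), (5, 7), (7, 4)]

def squareEdges : List (Fin 4 × Fin 4) := [(0, 1), (1, 2), (2, 3), (3, 0)]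

/-- The new piece is a single vertex, whose traces are the nonempty sets of tree half-edges. The
inner forest has one component, so it is a spanning path of the triangle. -/
theorem triangle_realizable : ∀ a b c : Bool,
    traceCheck (m := 1) [] [] (fun _ => 0) ![a, b, c] = true →
    realizable triangleEdges ![0, 1, 2]
      [[(1, 2), (0, 2)], [(0, 1), (1, 2)], [(0, 1), (0, 2)]]
      (fun _ => (0 : Fin 1)) [] ![a, b, c] = true := by
  decide +kernel

theorem k23_realizable : ∀ a b c : Bool,
    traceCheck (m := 1) [] [] (fun _ => 0) ![a, b, c] = true →
    realizable k23Edges ![2, 3, 4]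
      [[(0, 2), (0, 4), (1, 2), (1, 3)], [(0, 4), (1, 2), (1, 3), (1, 4)],
       [(0, 3), (1, 2), (1, 3), (1, 4)], [(0, 2), (1, 2), (1, 3), (1, 4)],
       [(0, 3), (0, 4), (1, 2), (1, 3)], [(0, 3), (0, 4), (1, 2), (1, 4)]]
      (fun _ => (0 : Fin 1)) [] ![a, b, c] = true := by
  decide +kernel

/-- The four vertices of degree 2 take the corners of the new square in cyclic order. All four
square edges together form a cycle, so this case is left out. -/
theorem clawSquare_realizable : ∀ a b c d : Bool, ∀ E ∈ squareEdges.sublists, E.length ≠ 4 →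
    traceCheck squareEdges E ![0, 1, 2, 3] ![a, b, c, d] = true →
    realizable clawSquareEdges ![3, 4, 5, 6]
      [[(1, 2), (2, 3), (3, 0), (7, 4), (7, 6), (0, 4), (1, 5)],
       [(0, 1), (2, 3), (7, 4), (7, 5), (7, 6), (1, 5), (2, 6)],
       [(1, 2), (2, 3), (3, 0), (7, 6), (0, 4), (1, 5), (2, 6)],
       [(1, 2), (3, 0), (7, 4), (7, 5), (7, 6), (0, 4), (1, 5)],
       [(1, 2), (2, 3), (3, 0), (7, 4), (0, 4), (1, 5), (2, 6)],
       [(0, 1), (2, 3), (7, 5), (7, 6), (0, 4), (1, 5), (2, 6)],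
       [(0, 1), (2, 3), (7, 4), (7, 6), (1, 5), (2, 6)],
       [(1, 2), (2, 3), (7, 5), (7, 6), (0, 4), (2, 6)],
       [(1, 2), (3, 0), (7, 5), (7, 6), (0, 4), (1, 5)],
       [(0, 1), (2, 3), (3, 0), (7, 4), (7, 6), (1, 5), (2, 6)],
       [(1, 2), (3, 0), (7, 6), (0, 4), (1, 5), (2, 6)],
       [(1, 2), (3, 0), (7, 4), (7, 5), (0, 4), (1, 5), (2, 6)],
       [(2, 3), (3, 0), (7, 4), (7, 5), (7, 6), (1, 5)],
       [(0, 1), (2, 3), (7, 4), (0, 4), (1, 5), (2, 6)],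
       [(2, 3), (3, 0), (7, 5), (1, 5)],
       [(0, 1), (1, 2), (3, 0), (7, 4), (7, 5), (2, 6)],
       [(0, 1), (1, 2), (2, 3), (7, 5), (7, 6), (0, 4)]]
      ![(0 : Fin 4), 1, 2, 3] E ![a, b, c, d] = true := by
  decide +kernel

/-- The half-edges `0` and `1` go to opposite corners of the new square, and so do `2` and `3`. -/
theorem twinHouse_realizable : ∀ a b c d : Bool, ∀ E ∈ squareEdges.sublists, E.length ≠ 4 →
    traceCheck squareEdges E ![0, 2, 1, 3] ![a, b, c, d] = true →
    realizable twinHouseEdges ![0, 1, 2, 3]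
      [[(0, 1), (0, 4), (4, 2), (5, 2), (5, 3)], [(0, 1), (1, 5), (4, 3), (5, 2), (5, 3)],
       [(0, 1), (0, 4), (4, 2), (4, 3), (5, 3)], [(0, 1), (0, 4), (4, 2), (4, 3), (5, 2)],
       [(0, 1), (1, 5), (4, 2), (5, 2), (5, 3)], [(0, 1), (1, 5), (4, 2), (4, 3), (5, 3)],
       [(0, 4), (1, 5), (4, 3), (5, 2)], [(0, 4), (1, 5), (4, 2), (5, 3)],
       [(0, 4), (4, 2), (4, 3), (5, 3)], [(0, 4), (4, 2), (4, 3), (5, 2)],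
       [(0, 1), (0, 4), (4, 3), (5, 2), (5, 3)], [(1, 5), (4, 3), (5, 2), (5, 3)],
       [(0, 1), (1, 5), (4, 2), (4, 3), (5, 2)], [(1, 5), (4, 2), (5, 2), (5, 3)],
       [(0, 4), (1, 5), (5, 2), (5, 3)], [(4, 3), (5, 3)]]
      ![(0 : Fin 4), 2, 1, 3] E ![a, b, c, d] = true := by
  decide +kernel

/-- The ends of the new edge stand for the contracted paths `0 4 2` and `1 5 3` of the domino. -/
theorem domino_realizable_edge : ∀ a b c d : Bool, ∀ E ∈ [((0 : Fin 2), (1 : Fin 2))].sublists,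
    traceCheck [(0, 1)] E ![0, 1, 0, 1] ![a, b, c, d] = true →
    realizable dominoEdges ![0, 1, 2, 3]
      [[(0, 1), (0, 4), (1, 5), (4, 2), (5, 3)], [(0, 1), (1, 5), (4, 5), (5, 3), (2, 3)],
       [(0, 1), (0, 4), (4, 5), (4, 2), (2, 3)], [(0, 4), (1, 5), (4, 2), (5, 3)],
       [(0, 4), (1, 5), (4, 2), (5, 3), (2, 3)], [(0, 4), (4, 5), (4, 2), (2, 3)],
       [(0, 1), (0, 4), (4, 5), (5, 3), (2, 3)], [(1, 5), (4, 5), (5, 3), (2, 3)],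
       [(0, 1), (1, 5), (4, 5), (4, 2), (2, 3)]]
      ![(0 : Fin 2), 1, 0, 1] E ![a, b, c, d] = true := by
  decide +kernel

/-- The half-edges keep their cyclic order `0 1 3 2`. In the exceptions the tree contains three
square edges and the half-edges of one of the paths `0 4 2` and `1 5 3`, and the half-edges of the
other path are in the matching. -/
theorem domino_realizable_square : ∀ a b c d : Bool, ∀ E ∈ squareEdges.sublists, E.length ≠ 4 →
    traceCheck squareEdges E ![0, 1, 3, 2] ![a, b, c, d] = true →
    realizable dominoEdges ![0, 1, 2, 3]
      [[(0, 4), (1, 5), (4, 2), (5, 3), (2, 3)], [(0, 1), (0, 4), (1, 5), (4, 2), (5, 3)],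
       [(0, 1), (1, 5), (4, 5), (5, 3), (2, 3)], [(0, 1), (0, 4), (4, 5), (4, 2), (2, 3)],
       [(0, 4), (1, 5), (4, 2), (5, 3)], [(0, 1), (4, 5), (5, 3), (2, 3)],
       [(0, 4), (4, 5), (4, 2), (2, 3)], [(1, 5), (4, 5), (5, 3), (2, 3)],
       [(0, 1), (4, 5), (4, 2), (2, 3)], [(4, 2), (5, 3)],
       [(0, 4), (1, 5), (4, 5), (2, 3)]]
      ![(0 : Fin 4), 1, 3, 2] E ![a, b, c, d] = true ∨
    E.length = 3 ∧ ((∀ i, innerLabel E ![a, b, c, d] ![(0 : Fin 4), 1, 3, 2] i = ![2, 0, 2, 0] i) ∨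
      ∀ i, innerLabel E ![a, b, c, d] ![(0 : Fin 4), 1, 3, 2] i = ![0, 2, 0, 2] i) := by
  decide +kernel

/-- The exception has two half-edges in the tree and the third one, `i`, in the matching. -/
theorem petersen_realizable : ∀ a b c : Bool,
    traceCheck (m := 1) [] [] (fun _ => 0) ![a, b, c] = true →
    realizable petersenEdges ![0, 3, 4]
      [[(0, 5), (1, 6), (2, 7), (3, 8), (6, 8), (8, 5), (5, 7), (7, 4)],
       [(2, 3), (0, 5), (1, 6), (3, 8), (4, 6), (6, 8), (8, 5), (5, 7)],
       [(1, 2), (0, 5), (1, 6), (3, 8), (4, 6), (6, 8), (8, 5), (5, 7)],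
       [(1, 2), (0, 5), (1, 6), (2, 7), (3, 8), (6, 8), (5, 7), (7, 4)]]
      (fun _ => (0 : Fin 1)) [] ![a, b, c] = true ∨
    ∃ i, ∀ j, innerLabel [] ![a, b, c] (fun _ => (0 : Fin 1)) j = if j = i then 2 else 0 := by
  decide +kernel

/-- This serves the repaired exception: all half-edges are in the tree, there are two inner
components, and `i` need not be linked to the other two half-edges. -/
theorem petersen_inner (i : Fin 3) : ∃ E, IsInner petersenEdges E ![0, 3, 4] (fun _ => 0)
    (fun j => if j = i then 1 else 0) 2 := by
  refine ⟨![[(2, 3), (1, 6), (3, 8), (4, 6), (6, 8), (8, 5), (7, 4)],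
    [(0, 1), (0, 5), (2, 7), (4, 6), (8, 5), (5, 7), (7, 4)],
    [(0, 1), (2, 3), (0, 5), (3, 8), (6, 8), (8, 5), (5, 7)]] i, isInner_of_innerCheck ?_⟩
  revert i
  decide +kernel

/-- This serves the repaired exceptions of the square: the half-edges `0` and `1` stay linked, and
the vertices `2` and `3` are components of their own. The other forest is its mirror image. -/
theorem domino_inner_left :
    IsInner dominoEdges [(0, 1), (0, 4), (1, 5)] ![0, 1, 2, 3] (fun _ => 0) ![0, 0, 1, 2] 3 :=
  isInner_of_innerCheck (by decide +kernel)

theorem domino_inner_right :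
    IsInner dominoEdges [(4, 2), (5, 3), (2, 3)] ![0, 1, 2, 3] (fun _ => 0) ![0, 1, 2, 2] 3 :=
  isInner_of_innerCheck (by decide +kernel)

end Tables

/-! ### Changing the interface, and 3-edge-connectivity after a replacement -/

section Replacement
open Finset

variable {O : Type u} [Fintype O] {n m k : ℕ}

/-- The new links need not contain the old ones; it is enough that they generate them together with
`T`. -/
theorem IsOuter.congr {K T : SimpleGraph O} {o : Fin k → O} {L L' cl cl' : Fin k → ℕ} {r r' : ℕ}
    (h : IsOuter K T o L cl r) (hL : ∀ i, L i = L' i) (hr : r = r')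
    (hcl : ∀ Z : O → Prop, (∀ u v, T.Adj u v → Z u → Z v) →
      (∀ i j, L' i = 0 → L' j = 0 → cl' i = cl' j → Z (o i) → Z (o j)) →
      ∀ i j, L i = 0 → L j = 0 → cl i = cl j → Z (o i) → Z (o j)) :
    IsOuter K T o L' cl' r' := by
  obtain rfl : L = L' := funext hL
  subst hr
  exact ⟨h.le, h.deg_eq, h.half, h.sum, fun Z hZ hl => h.conn Z hZ (hcl Z hZ hl)⟩

/-- A half-edge of the matching can be added to the tree, together with a new inner component. -/
theorem IsOuter.absorb {K T : SimpleGraph O} {o : Fin k → O} {L cl : Fin k → ℕ} {r : ℕ}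
    (h : IsOuter K T o L cl r) (hK : ∀ u, deg (wt K) u + halves (fun _ => true) o u = 3)
    (i : Fin k) (hi : L i = 2) {cl' : Fin k → ℕ}
    (hcl : ∀ a b, L a = 0 → L b = 0 → cl a = cl b → cl' a = cl' b) :
    IsOuter K T o (Function.update L i 0) cl' (r + 1) := by
  classical
  have hth : ∀ j, treeHalf (Function.update L i 0) j = true ↔ treeHalf L j = true ∨ j = i := by
    intro j
    rw [treeHalf_iff, treeHalf_iff]
    by_cases hj : j = i
    · subst hj; simp
    · simp [hj]
  have hti : treeHalf L i = false := treeHalf_eq_false.2 (by omega)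
  have hdeg : ∀ u, outerDeg T o (Function.update L i 0) u =
      outerDeg T o L u + if o i = u then 1 else 0 := by
    intro u
    unfold outerDeg halves
    have e : (if o i = u then 1 else 0) = ∑ j, if j = i ∧ o j = u then 1 else 0 := by
      rw [Finset.sum_eq_single i]
      · simp
      · intro j _ hj; simp [hj]
      · simp
    rw [e, add_assoc, ← Finset.sum_add_distrib]
    congr 1
    refine Finset.sum_congr rfl fun j _ => ?_
    have := hth j
    by_cases h1 : j = i
    · subst h1; simp [hth, hti]
    · simp [hth, h1]
  have htot : ∀ u, 3 = outerDeg T o L u + (deg (wt (K \ T)) u +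
      ∑ j, if treeHalf L j = false ∧ o j = u then 1 else 0) := by
    intro u
    have e : halves (fun _ => true) o u = halves (treeHalf L) o u +
        ∑ j, if treeHalf L j = false ∧ o j = u then 1 else 0 := by
      unfold halves
      rw [← Finset.sum_add_distrib]
      refine Finset.sum_congr rfl fun j _ => ?_
      cases treeHalf L j <;> simp
    have := hK u
    have := deg_add_deg_sdiff h.le u
    unfold outerDeg
    omega
  -- As `o i` has tree degree 2, the half-edge `i` is the only cotree edge there. Raising the degree
  -- to 3 therefore affects no other degree condition.
  have h2 := h.half i (by omega)
  rw [hi] at h2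
  have h3 := htot (o i)
  have hge : ∀ j, treeHalf L j = false → o j = o i → j = i := by
    intro j hj ho
    by_contra hne
    have : 2 ≤ ∑ j, if treeHalf L j = false ∧ o j = o i then 1 else 0 := by
      refine le_trans ?_ (Finset.sum_le_sum_of_subset (Finset.subset_univ {i, j}))
      rw [Finset.sum_pair (Ne.symm hne)]
      simp [hti, hj, ho]
    omega
  have hone : 1 ≤ ∑ j, if treeHalf L j = false ∧ o j = o i then 1 else 0 := by
    refine le_trans ?_ (Finset.single_le_sum (fun _ _ => Nat.zero_le _) (Finset.mem_univ i))
    simp [hti]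
  have hKT : ∀ v, ¬(K \ T).Adj (o i) v := by
    intro v hv
    have : 1 ≤ deg (wt (K \ T)) (o i) := by
      refine le_trans ?_ (Finset.single_le_sum (fun _ _ => Nat.zero_le _) (Finset.mem_univ v))
      rw [wt_of_adj hv]
    omega
  refine ⟨h.le, fun u v huv hn => ?_, fun j hj => ?_, ?_, fun Z hZ hl => h.conn Z hZ ?_⟩
  · rw [hdeg, hdeg, if_neg, if_neg, h.deg_eq u v huv hn]
    · rintro rfl
      exact hKT u ⟨huv.symm, fun h => hn h.symm⟩
    · rintro rfl
      exact hKT v ⟨huv, hn⟩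
  · have hji : j ≠ i := by rintro rfl; simp at hj
    rw [Function.update_of_ne hji] at hj ⊢
    have hne : o i ≠ o j := fun ho => hji (hge j (treeHalf_eq_false.2 hj) ho.symm)
    rw [hdeg, if_neg hne, add_zero, h.half j hj]
  -- The half-edge counts once in the degree of `o i` and once among the tree halves; this balances
  -- the step from `r` to `r + 1`.
  · have e : (∑ j, if treeHalf (Function.update L i 0) j = true then 1 else 0) =
        (∑ j, if treeHalf L j = true then 1 else 0) + 1 := by
      have e' : 1 = ∑ j, if j = i then 1 else 0 := by simp
      conv_rhs => rw [e']
      rw [← Finset.sum_add_distrib]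
      refine Finset.sum_congr rfl fun j _ => ?_
      by_cases h1 : j = i
      · subst h1; simp [hth, hti]
      · simp [hth, h1]
    have := h.sum
    rw [e]
    simp only [hdeg, Finset.sum_add_distrib, Finset.sum_ite_eq, Finset.mem_univ, if_true]
    omega
  · intro a b ha hb hc
    have hne : ∀ j, L j = 0 → j ≠ i := by rintro j hj rfl; omega
    exact hl a b (by rw [Function.update_of_ne (hne a ha), ha])
      (by rw [Function.update_of_ne (hne b hb), hb]) (hcl a b ha hb hc)

/-- The matching half-edges `a` and `c` both enter the tree. A former inner link between `b` and `d`
is replaced by a detour: from `o b` to `o c` in the outer forest, and from `c` to `d` inside. -/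
theorem IsOuter.absorb_two {K T : SimpleGraph O} {o : Fin 4 → O} {L cl : Fin 4 → ℕ} {r : ℕ}
    (h : IsOuter K T o L cl r) (hK : ∀ u, deg (wt K) u + halves (fun _ => true) o u = 3)
    {a b c d : Fin 4} (hall : ∀ i, i = a ∨ i = b ∨ i = c ∨ i = d) (hac : a ≠ c) (ha : L a = 2)
    (hb : L b = 0) (hc : L c = 2) (hd : L d = 0) (hr : T.Reachable (o c) (o b)) {cl' : Fin 4 → ℕ}
    (hcl : cl' c = cl' d) : IsOuter K T o (fun _ => 0) cl' (r + 2) := by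
  have hzero : ∀ i, L i = 0 → i = b ∨ i = d := by
    intro i hi
    rcases hall i with rfl | rfl | rfl | rfl
    · omega
    · exact Or.inl rfl
    · omega
    · exact Or.inr rfl
  -- Provisional links: `b` and `d` are joined, every other half-edge is alone.
  have h1 := h.absorb hK a ha (cl' := fun j => if j = b ∨ j = d then 0 else j.1 + 1)
    (fun i j hi hj _ => by simp [hzero i hi, hzero j hj])
  have h2 := h1.absorb hK c (by rw [Function.update_of_ne hac.symm, hc]) (fun _ _ _ _ h => h)
  refine h2.congr (fun i => ?_) rfl fun Z hZ hl => ?_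
  · by_cases hic : i = c
    · subst hic; simp
    · by_cases hia : i = a
      · subst hia; simp [hac]
      · rw [Function.update_of_ne hic, Function.update_of_ne hia]
        rcases hall i with rfl | rfl | rfl | rfl <;> simp_all
  · have hcb : Z (o c) ↔ Z (o b) := ⟨reachable_induct hZ hr, reachable_induct hZ hr.symm⟩
    have hcd : Z (o c) ↔ Z (o d) := ⟨hl c d rfl rfl hcl, hl d c rfl rfl hcl.symm⟩
    intro i j _ _ hij
    by_cases hi : i = b ∨ i = d <;> by_cases hj : j = b ∨ j = d
    · rcases hi with rfl | rfl <;> rcases hj with rfl | rfl <;> tauto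
    · simp [hi, hj] at hij
    · simp [hi, hj] at hij
    · simp only [hi, hj, if_false, Nat.add_right_cancel_iff] at hij
      rw [Fin.ext hij]
      exact id

/-- If only one edge of `K` joins `{u | z u}` to its complement, then not both of two given tree
components meet both sides. -/
theorem IsOuter.reachable_or {K T : SimpleGraph O} {o : Fin 4 → O} {L cl : Fin 4 → ℕ} {r : ℕ}
    (h : IsOuter K T o L cl r) {a b c d : Fin 4} (hL : ∀ i, L i = 0 → i = b ∨ i = d)
    {z : O → Bool} (hz : cut (wt K) z ≤ 1) (ha : z (o a) = true) (hb : z (o b) = false)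
    (hc : z (o c) = true) (hd : z (o d) = false) :
    T.Reachable (o c) (o b) ∨ T.Reachable (o a) (o d) := by
  classical
  have hbd : ∀ v, T.Reachable v (o b) ∨ T.Reachable v (o d) := by
    intro v
    refine h.conn (fun v => T.Reachable v (o b) ∨ T.Reachable v (o d)) ?_ ?_ (o b) v
      (Or.inl .rfl)
    · rintro x y hxy (h | h)
      · exact Or.inl (hxy.symm.reachable.trans h)
      · exact Or.inr (hxy.symm.reachable.trans h)
    · intro i j hi hj _ _
      rcases hL j hj with rfl | rfl
      · exact Or.inl .rfl
      · exact Or.inr .rfl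
  have huniq : ∀ x y x' y', T.Adj x y → T.Adj x' y' → z x = true → z y = false → z x' = true →
      z y' = false → x = x' := by
    intro x y x' y' h1 h2 hx hy hx' hy'
    by_contra hne
    have hone : ∀ x y, T.Adj x y → z x = true → z y = false →
        1 ≤ ∑ v, if z x && !z v then wt K x v else 0 := by
      intro x y h1 hx hy
      refine le_trans ?_ (Finset.single_le_sum (f := fun v => if z x && !z v then wt K x v else 0)
        (fun _ _ => Nat.zero_le _) (Finset.mem_univ y))
      simp [hx, hy, wt_of_adj (h.le h1)]
    have : 2 ≤ cut (wt K) z := by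
      refine le_trans ?_ (Finset.sum_le_sum_of_subset (Finset.subset_univ {x, x'}))
      rw [Finset.sum_pair hne]
      have := hone x y h1 hx hy
      have := hone x' y' h2 hx' hy'
      omega
    omega
  have hcross : ∀ u v, T.Reachable u v → z u = true → z v = false →
      ∃ x y, T.Reachable u x ∧ T.Adj x y ∧ z x = true ∧ z y = false := by
    intro u v huv hu hv
    by_contra hcon
    push Not at hcon
    have := reachable_induct (Z := fun x => T.Reachable u x ∧ z x = true) (fun x y hxy hx =>
      ⟨hx.1.trans hxy.reachable, by simpa using hcon x y hx.1 hxy hx.2⟩) huv ⟨.rfl, hu⟩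
    simp [hv] at this
  -- If `o a` is joined to `o b` and `o c` to `o d`, then both connections cross the cut at the same
  -- vertex, so all four ends are in one component.
  rcases hbd (o a) with h1 | h1
  · rcases hbd (o c) with h2 | h2
    · exact Or.inl h2
    · obtain ⟨x, y, hx, hxy, hzx, hzy⟩ := hcross _ _ h1 ha hb
      obtain ⟨x', y', hx', hxy', hzx', hzy'⟩ := hcross _ _ h2 hc hd
      obtain rfl := huniq _ _ _ _ hxy hxy' hzx hzy hzx' hzy'
      exact Or.inl (hx'.trans (hx.symm.trans h1))
  · exact Or.inr h1

variable {K : SimpleGraph O} {H : List (Fin n × Fin n)} {o : Fin k → O} {s : Fin k → Fin n}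
  {G : SimpleGraph (O ⊕ Fin n)}

theorem glueWt_comm {O : Type u} (K : SimpleGraph O) (E : List (Fin n × Fin n)) (τ : Fin k → Bool)
    (o : Fin k → O) (s : Fin k → Fin n) (x y : O ⊕ Fin n) :
    glueWt (wt K) (listWt E) τ o s x y = glueWt (wt K) (listWt E) τ o s y x := by
  rcases x with u | a <;> rcases y with v | b
  · exact wt_comm K u v
  · rfl
  · rfl
  · exact listWt_comm E a b

theorem cut_zero_const (H : Fin n → Fin n → ℕ) (c : Bool) : cut H (fun _ => c) = 0 := by
  simp [cut]

theorem deg_add_halves (hG : IsCubicMultigraph (wt G))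
    (hw : wt G = glueWt (wt K) (listWt H) (fun _ => true) o s) (u : O) :
    deg (wt K) u + halves (fun _ => true) o u = 3 := by
  rw [← hG.deg_eq (.inl u), hw, deg_glueWt_inl]

/-- With the whole piece on the side `c`, only edges of `K` and half-edges can cross. -/
theorem three_le_cut_outer (hG : IsCubicMultigraph (wt G))
    (hw : wt G = glueWt (wt K) (listWt H) (fun _ => true) o s) [NeZero n] (z : O → Bool) (c : Bool)
    (hne : ∃ u, z u = !c) :
    3 ≤ cut (wt K) z + ∑ i, if z (o i) ≠ c then 1 else 0 := by
  obtain ⟨u, hu⟩ := hne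
  have := hG.three_le_cut (fun x => match x with | .inl u => z u | .inr _ => c) ?_ ?_
  · rw [hw, cut_glueWt, cut_zero_const] at this
    simpa using this
  · cases c
    · exact ⟨.inl u, hu⟩
    · exact ⟨.inr 0, rfl⟩
  · cases c
    · exact ⟨.inr 0, rfl⟩
    · exact ⟨.inl u, hu⟩

/-- A cut that does not split the new piece has the same size as a cut of `G` that does not split
the old one. Only the cuts through the new piece are left as a hypothesis. -/
theorem isCubicMultigraph_glue (hG : IsCubicMultigraph (wt G))
    (hw : wt G = glueWt (wt K) (listWt H) (fun _ => true) o s) [NeZero n] [NeZero m]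
    {H' : List (Fin m × Fin m)} {t : Fin k → Fin m} (hH' : ∀ e ∈ H', e.1 ≠ e.2)
    (hdeg : ∀ a, pieceDeg H' (fun _ => true) t a = 3)
    (hcut : ∀ z : O ⊕ Fin m → Bool, (∃ a b, z (.inr a) = true ∧ z (.inr b) = false) →
      3 ≤ cut (glueWt (wt K) (listWt H') (fun _ => true) o t) z) :
    IsCubicMultigraph (glueWt (wt K) (listWt H') (fun _ => true) o t) := by
  refine ⟨glueWt_comm K H' _ o t, ?_, ?_, fun z hz hz' => ?_⟩
  · rintro (u | a)
    · exact wt_self K u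
    · exact listWt_self hH' a
  · rintro (u | a)
    · rw [deg_glueWt_inl, deg_add_halves hG hw]
    · rw [deg_glueWt_list_inr _ hH', hdeg]
  · by_cases h : ∃ a b, z (.inr a) = true ∧ z (.inr b) = false
    · exact hcut z h
    · have hconst : ∀ a, z (.inr a) = z (.inr 0) := by
        intro a
        push Not at h
        have h1 := h a 0
        have h2 := h 0 a
        cases h3 : z (.inr a) <;> cases h4 : z (.inr 0) <;> simp_all
      have hfun : (fun a => z (.inr a)) = fun _ => z (.inr 0) := funext hconst
      rw [cut_glueWt, hfun, cut_zero_const]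
      have hex : ∃ u, z (.inl u) = !z (.inr 0) := by
        cases h0 : z (.inr 0)
        · obtain ⟨x | a, hx⟩ := hz
          · exact ⟨x, by simpa using hx⟩
          · simp [hconst a, h0] at hx
        · obtain ⟨x | a, hx⟩ := hz'
          · exact ⟨x, by simpa using hx⟩
          · simp [hconst a, h0] at hx
      have := three_le_cut_outer hG hw (fun u => z (.inl u)) (z (.inr 0)) hex
      simpa [hconst] using this

end Replacement

/-! ### Reducing the configurations in a critical graph -/

section Contradiction
open Finset

variable {O : Type u} [Fintype O] {n m k : ℕ} {K : SimpleGraph O} {H : List (Fin n × Fin n)}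
  {s : Fin k → Fin n} {o : Fin k → O} {G : SimpleGraph (O ⊕ Fin n)}

theorem IsCritical.not_isInner (hG : IsCritical G)
    (hw : wt G = glueWt (wt K) (listWt H) (fun _ => true) o s) (hH : ∀ e ∈ H, e.1 ≠ e.2)
    (hO : Nonempty O) {T : SimpleGraph O} {L cl : Fin k → ℕ} {r : ℕ} (hT : IsOuter K T o L cl r)
    {E : List (Fin n × Fin n)} : ¬IsInner H E s L cl r := fun hE => by
  obtain ⟨T', hT'⟩ := hE.exists_isGoodTree hT hH hw hO
  exact hG.no_tree T' hT'

theorem IsCritical.not_realizable (hG : IsCritical G)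
    (hw : wt G = glueWt (wt K) (listWt H) (fun _ => true) o s) (hH : ∀ e ∈ H, e.1 ≠ e.2)
    (hO : Nonempty O) {T : SimpleGraph O} {E : List (Fin m × Fin m)} {τ : Fin k → Bool}
    {t : Fin k → Fin m}
    (hT : IsOuter K T o (innerLabel E τ t) (fun i => comp E (t i)) (m - E.length))
    {F : List (List (Fin n × Fin n))} : realizable H s F t E τ ≠ true := fun hr => by
  obtain ⟨E', _, hE'⟩ := List.any_eq_true.1 hr
  exact hG.not_isInner hw hH hO hT (isInner_of_innerCheck hE')

theorem IsCritical.exists_outer (hG : IsCritical G) {H' : List (Fin m × Fin m)} {t : Fin k → Fin m}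
    (hH' : ∀ e ∈ H', e.1 ≠ e.2)
    (hc : IsCubicMultigraph (glueWt (wt K) (listWt H') (fun _ => true) o t))
    (hlen : H'.length ≤ m) (hmn : m < n) (hcard : 2 < Fintype.card O + m) (hO : Nonempty O) :
    ∃ (S : SimpleGraph (O ⊕ Fin m)) (E : List (Fin m × Fin m)) (τ : Fin k → Bool),
      S.IsAcyclic ∧ IsTrace H' E t τ ∧ (∀ e ∈ E, S.Adj (.inr e.1) (.inr e.2)) ∧
      IsOuter K (S.comap Sum.inl) o (innerLabel E τ t) (fun i => comp E (t i)) (m - E.length) := by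
  have h2 : 2 < Fintype.card (O ⊕ Fin m) := by simpa using hcard
  obtain ⟨S, hS⟩ := hG.exists_tree (O ⊕ Fin m) _ hc h2 (by simpa using hmn)
  obtain ⟨E, τ, h⟩ := hS.exists_trace hH' (hc.wt_ofWt h2) hlen hO
  exact ⟨S, E, τ, hS.tree.isAcyclic, h⟩

/-- If there is only one outer vertex, then the contraction is a triple edge, to which minimality
does not apply. Its good tree, a single edge, is written down directly. -/
theorem IsCritical.exists_outer_contract {s : Fin 3 → Fin n} {o : Fin 3 → O} (hG : IsCritical G)
    (hw : wt G = glueWt (wt K) (listWt H) (fun _ => true) o s) (hn : 1 < n) :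
    ∃ (T : SimpleGraph O) (τ : Fin 3 → Bool),
      traceCheck (m := 1) [] [] (fun _ => 0) τ = true ∧
      IsOuter K T o (innerLabel [] τ (fun _ => (0 : Fin 1)))
        (fun _ => comp ([] : List (Fin 1 × Fin 1)) 0) 1 := by
  classical
  have : NeZero n := ⟨by omega⟩
  have hO : Nonempty O := ⟨o 0⟩
  by_cases hcard : 1 < Fintype.card O
  · have hc : IsCubicMultigraph (glueWt (wt K) (listWt []) (fun _ => true) o
        (fun _ => (0 : Fin 1))) := by
      refine isCubicMultigraph_glue hG.cubic hw (by simp) (by decide) ?_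
      rintro z ⟨a, b, ha, hb⟩
      rw [Subsingleton.elim a b, hb] at ha
      simp at ha
    obtain ⟨S, E, τ, -, h1, -, h2⟩ := hG.exists_outer (by simp) hc (by simp) hn (by omega) hO
    obtain rfl : E = [] := List.sublist_nil.1 h1.sub
    exact ⟨_, τ, h1.traceCheck, h2⟩
  · have hsub : Subsingleton O := Fintype.card_le_one_iff_subsingleton.1 (by omega)
    have hcard1 : Fintype.card O = 1 := le_antisymm (by omega) Fintype.card_pos
    have hd : ∀ u, outerDeg (⊥ : SimpleGraph O) o
        (innerLabel [] ![true, false, false] (fun _ => (0 : Fin 1))) u = 1 := by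
      intro u
      have h0 : deg (wt (⊥ : SimpleGraph O)) u = 0 :=
        Finset.sum_eq_zero fun v _ => wt_of_not_adj (by simp)
      rw [outerDeg, h0, halves, zero_add, Fin.sum_univ_three]
      simp [Subsingleton.elim _ u, treeHalf_iff, innerLabel, pieceDeg, listDeg, halfDeg,
        List.finRange]
    refine ⟨⊥, ![true, false, false], by decide, bot_le, fun u v huv _ => ?_, fun i hi => ?_, ?_,
      fun Z _ _ u v hu => Subsingleton.elim u v ▸ hu⟩
    · exact absurd (Subsingleton.elim u v) huv.ne
    · rw [hd]
      revert hi
      revert i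
      decide
    · simp only [hd, Finset.sum_const, Finset.card_univ, hcard1]
      decide

theorem vec_three_eta (τ : Fin 3 → Bool) : τ = ![τ 0, τ 1, τ 2] := by
  ext i; fin_cases i <;> rfl

theorem vec_four_eta (τ : Fin 4 → Bool) : τ = ![τ 0, τ 1, τ 2, τ 3] := by
  ext i; fin_cases i <;> rfl

theorem IsCritical.false_of_contract {s : Fin 3 → Fin n} {o : Fin 3 → O} (hG : IsCritical G)
    (hw : wt G = glueWt (wt K) (listWt H) (fun _ => true) o s) (hn : 1 < n)
    (hH : ∀ e ∈ H, e.1 ≠ e.2) {F : List (List (Fin n × Fin n))}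
    (hF : ∀ a b c : Bool, traceCheck (m := 1) [] [] (fun _ => 0) ![a, b, c] = true →
      realizable H s F (fun _ => (0 : Fin 1)) [] ![a, b, c] = true) : False := by
  obtain ⟨T, τ, h1, h2⟩ := hG.exists_outer_contract hw hn
  rw [vec_three_eta τ] at h1 h2
  exact hG.not_realizable (m := 1) hw hH ⟨o 0⟩ h2 (hF _ _ _ h1)

theorem IsCritical.false_of_petersen {o : Fin 3 → O}
    {G : SimpleGraph (O ⊕ Fin 9)} (hG : IsCritical G)
    (hw : wt G = glueWt (wt K) (listWt petersenEdges) (fun _ => true) o ![0, 3, 4]) : False := by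
  obtain ⟨T, τ, h1, h2⟩ := hG.exists_outer_contract hw (by norm_num)
  rw [vec_three_eta τ] at h1 h2
  rcases petersen_realizable _ _ _ h1 with h | ⟨i, hi⟩
  · exact hG.not_realizable (m := 1) hw (by decide) ⟨o 0⟩ h2 h
  · have h3 := h2.absorb (deg_add_halves hG.cubic hw) i (by rw [hi]; simp)
      (cl' := fun j => if j = i then 1 else 0) (fun a b ha hb _ => by
        rw [hi] at ha hb
        rw [if_neg fun h => by simp [h] at ha, if_neg fun h => by simp [h] at hb])
    obtain ⟨E, hE⟩ := petersen_inner i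
    refine hG.not_isInner hw (by decide) ⟨o 0⟩ (h3.congr (L' := fun _ => 0) (fun j => ?_) rfl
      fun Z _ hl a b _ _ => hl a b rfl rfl) hE
    by_cases hj : j = i
    · subst hj; simp
    · rw [Function.update_of_ne hj, hi, if_neg hj]

theorem two_le_cut_square : ∀ z : Fin 4 → Bool, (∃ a b, z a = true ∧ z b = false) →
    2 ≤ cut (listWt squareEdges) z := by
  decide +kernel

/-- A cut through the square uses two of its edges, so a cut of size at most 2 contains nothing
else. Each side would then carry at least three of the four half-edges. -/
theorem isCubicMultigraph_square {s o : _} {t : Fin 4 → Fin 4} [NeZero n]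
    (hG : IsCubicMultigraph (wt G))
    (hw : wt G = glueWt (wt K) (listWt H) (fun _ => true) (o : Fin 4 → O) (s : Fin 4 → Fin n))
    (ht : Function.Bijective t) :
    IsCubicMultigraph (glueWt (wt K) (listWt squareEdges) (fun _ => true) o t) := by
  classical
  refine isCubicMultigraph_glue hG hw (by decide) ?_ ?_
  · intro a
    have : halfDeg (fun _ => true) t a = 1 := by
      rw [halfDeg_eq, halves]
      obtain ⟨i, rfl⟩ := ht.2 a
      rw [Finset.sum_eq_single i]
      · simp
      · intro j _ hj
        simp [ht.1.ne hj]
      · simp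
    rw [pieceDeg, this]
    clear this
    revert a
    decide
  · rintro z ⟨a, b, ha, hb⟩
    rw [cut_glueWt]
    have h2 := two_le_cut_square (fun a => z (.inr a)) ⟨a, b, ha, hb⟩
    by_contra hlt
    have h0 : (∑ i, if true = true ∧ z (.inl (o i)) ≠ z (.inr (t i)) then 1 else 0)
        = 0 := by omega
    have hK : cut (wt K) (fun u => z (.inl u)) = 0 := by omega
    have heq : ∀ i, z (.inl (o i)) = z (.inr (t i)) := by
      intro i
      have := (Finset.sum_eq_zero_iff.1 h0) i (Finset.mem_univ i)
      by_contra hne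
      simp [hne] at this
    obtain ⟨i, rfl⟩ := ht.2 a
    obtain ⟨j, rfl⟩ := ht.2 b
    have c1 := three_le_cut_outer hG hw (fun u => z (.inl u)) false ⟨o i, by simp [heq, ha]⟩
    have c2 := three_le_cut_outer hG hw (fun u => z (.inl u)) true ⟨o j, by simp [heq, hb]⟩
    rw [hK, zero_add] at c1 c2
    have : (∑ i, if z (.inl (o i)) ≠ false then 1 else 0) +
        (∑ i, if z (.inl (o i)) ≠ true then 1 else 0) = 4 := by
      rw [← Finset.sum_add_distrib]
      refine (Finset.sum_congr rfl fun i _ => ?_).trans (Fin.sum_const 4 1)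
      cases z (.inl (o i)) <;> rfl
    omega

theorem not_isAcyclic_of_square {X : Type u} {S : SimpleGraph (X ⊕ Fin 4)}
    (h : ∀ e ∈ squareEdges, S.Adj (.inr e.1) (.inr e.2)) : ¬S.IsAcyclic := by
  rw [SimpleGraph.isAcyclic_iff_free_cycleGraph]
  intro hf
  refine hf 4 (by norm_num) ⟨⟨⟨Sum.inr, fun {i j} hij => ?_⟩, Sum.inr_injective⟩⟩
  have key : ∀ i j : Fin 4, (SimpleGraph.cycleGraph 4).Adj i j →
      (i, j) ∈ squareEdges ∨ (j, i) ∈ squareEdges := by decide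
  rcases key i j hij with h' | h'
  · exact h _ h'
  · exact (h _ h').symm

theorem IsCritical.exists_outer_square {s : Fin 4 → Fin n} {o : Fin 4 → O} {t : Fin 4 → Fin 4}
    (hG : IsCritical G) (hw : wt G = glueWt (wt K) (listWt H) (fun _ => true) o s) (hn : 4 < n)
    (ht : Function.Bijective t) :
    ∃ (T : SimpleGraph O) (E : List (Fin 4 × Fin 4)) (τ : Fin 4 → Bool),
      E ∈ squareEdges.sublists ∧ E.length ≠ 4 ∧ traceCheck squareEdges E t τ = true ∧
      IsOuter K T o (innerLabel E τ t) (fun i => comp E (t i)) (4 - E.length) := by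
  have : NeZero n := ⟨by omega⟩
  have hO : Nonempty O := ⟨o 0⟩
  have := Fintype.card_pos (α := O)
  obtain ⟨S, E, τ, h0, h1, h2, h3⟩ := hG.exists_outer (by decide)
    (isCubicMultigraph_square hG.cubic hw ht) (by decide) hn (by omega) hO
  refine ⟨_, E, τ, List.mem_sublists.2 h1.sub, fun h4 => ?_, h1.traceCheck, h3⟩
  have : E = squareEdges := h1.sub.eq_of_length (by rw [h4]; rfl)
  exact not_isAcyclic_of_square (this ▸ h2) h0

theorem IsCritical.false_of_square {s : Fin 4 → Fin n} {o : Fin 4 → O} {t : Fin 4 → Fin 4}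
    (hG : IsCritical G) (hw : wt G = glueWt (wt K) (listWt H) (fun _ => true) o s) (hn : 4 < n)
    (ht : Function.Bijective t) (hH : ∀ e ∈ H, e.1 ≠ e.2) {F : List (List (Fin n × Fin n))}
    (hF : ∀ a b c d : Bool, ∀ E ∈ squareEdges.sublists, E.length ≠ 4 →
      traceCheck squareEdges E t ![a, b, c, d] = true →
      realizable H s F t E ![a, b, c, d] = true) : False := by
  obtain ⟨T, E, τ, h1, h2, h3, h4⟩ := hG.exists_outer_square hw hn ht
  rw [vec_four_eta τ] at h3 h4
  exact hG.not_realizable hw hH ⟨o 0⟩ h4 (hF _ _ _ _ E h1 h2 h3)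

/-- A bad cut contains the new edge and at most one other edge. That one is no half-edge, since
otherwise a union of components of `K` would be attached to the piece by a single half-edge of `G`.
-/
theorem exists_small_cut {s : Fin 4 → Fin n} {o : Fin 4 → O} [NeZero n]
    (hG : IsCubicMultigraph (wt G))
    (hw : wt G = glueWt (wt K) (listWt H) (fun _ => true) o s)
    (hcut : ¬∀ z : O ⊕ Fin 2 → Bool, (∃ a b, z (.inr a) = true ∧ z (.inr b) = false) →
      3 ≤ cut (glueWt (wt K) (listWt [((0 : Fin 2), (1 : Fin 2))]) (fun _ => true) o
        ![0, 1, 0, 1]) z) :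
    ∃ z : O → Bool, cut (wt K) z ≤ 1 ∧ z (o 0) = true ∧ z (o 1) = false ∧ z (o 2) = true ∧
      z (o 3) = false := by
  classical
  obtain ⟨z, hz, h0, h1⟩ : ∃ z : O ⊕ Fin 2 → Bool,
      cut (glueWt (wt K) (listWt [((0 : Fin 2), (1 : Fin 2))]) (fun _ => true) o
        ![0, 1, 0, 1]) z ≤ 2 ∧ z (.inr 0) = true ∧ z (.inr 1) = false := by
    push Not at hcut
    obtain ⟨z, ⟨a, b, ha, hb⟩, hz⟩ := hcut
    fin_cases a <;> fin_cases b
    · exact absurd ha (by simpa using hb)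
    · exact ⟨z, by omega, ha, hb⟩
    · refine ⟨fun x => !z x, ?_, ?_, ?_⟩
      · rw [cut_compl (glueWt_comm _ _ _ _ _)]; omega
      · simpa using hb
      · simpa using ha
    · exact absurd ha (by simpa using hb)
  refine ⟨fun u => z (.inl u), ?_⟩
  have hfun : (fun a => z (.inr a)) = ![true, false] := by
    ext a; fin_cases a
    · exact h0
    · exact h1
  have hone : cut (listWt [((0 : Fin 2), (1 : Fin 2))]) ![true, false] = 1 := by decide
  rw [cut_glueWt, hfun, hone, Fin.sum_univ_four] at hz
  have c1 := three_le_cut_outer hG hw (fun u => z (.inl u)) false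
  have c2 := three_le_cut_outer hG hw (fun u => z (.inl u)) true
  rw [Fin.sum_univ_four] at c1 c2
  simp only [Matrix.cons_val, h0, h1] at hz
  have e1 : ∀ i b, z (.inl (o i)) = b → ∃ u, z (.inl u) = b := fun i b h => ⟨_, h⟩
  have f0 := e1 0
  have f1 := e1 1
  have f2 := e1 2
  have f3 := e1 3
  cases x0 : z (.inl (o 0)) <;> cases x1 : z (.inl (o 1)) <;> cases x2 : z (.inl (o 2)) <;>
    cases x3 : z (.inl (o 3)) <;> simp_all

/-- If the edge is an admissible replacement, then every trace is realizable. If not, the small cut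
between the half-edges `0`, `2` and `1`, `3` supplies the outer connection that `IsOuter.absorb_two`
needs for the exceptional traces of the square. -/
theorem IsCritical.false_of_domino {o : Fin 4 → O} {G : SimpleGraph (O ⊕ Fin 6)}
    (hG : IsCritical G)
    (hw : wt G = glueWt (wt K) (listWt dominoEdges) (fun _ => true) o ![0, 1, 2, 3]) : False := by
  classical
  have hO : Nonempty O := ⟨o 0⟩
  have hpos := Fintype.card_pos (α := O)
  have hloop : ∀ e ∈ dominoEdges, e.1 ≠ e.2 := by decide
  by_cases hcut : ∀ z : O ⊕ Fin 2 → Bool, (∃ a b, z (.inr a) = true ∧ z (.inr b) = false) →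
      3 ≤ cut (glueWt (wt K) (listWt [((0 : Fin 2), (1 : Fin 2))]) (fun _ => true) o
        ![0, 1, 0, 1]) z
  · have hc := isCubicMultigraph_glue hG.cubic hw (by decide) (by decide) hcut
    obtain ⟨S, E, τ, -, h1, -, h3⟩ := hG.exists_outer (by decide) hc (by decide) (by norm_num)
      (by omega) hO
    have h4 := h1.traceCheck
    rw [vec_four_eta τ] at h3 h4
    exact hG.not_realizable hw hloop hO h3
      (domino_realizable_edge _ _ _ _ E (List.mem_sublists.2 h1.sub) h4)
  · obtain ⟨z, hz, h0, h1, h2, h3⟩ := exists_small_cut hG.cubic hw hcut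
    obtain ⟨T, E, τ, g1, g2, g3, g4⟩ := hG.exists_outer_square (t := ![0, 1, 3, 2]) hw
      (by norm_num) (by decide)
    rw [vec_four_eta τ] at g3 g4
    have hK := deg_add_halves hG.cubic hw
    rcases domino_realizable_square _ _ _ _ E g1 g2 g3 with h | ⟨hE, h | h⟩
    · exact hG.not_realizable hw hloop hO g4 h
    · rw [hE] at g4
      have hL : ∀ i, innerLabel E ![τ 0, τ 1, τ 2, τ 3] ![(0 : Fin 4), 1, 3, 2] i = 0 →
          i = 1 ∨ i = 3 := by
        intro i; rw [h]; revert i; decide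
      rcases g4.reachable_or (a := 0) (b := 1) (c := 2) (d := 3) hL hz h0 h1 h2 h3 with hr | hr
      · exact hG.not_isInner hw hloop hO (g4.absorb_two hK (a := 0) (d := 3) (by decide)
          (by decide) (h 0) (h 1) (h 2) (h 3) hr rfl) domino_inner_right
      · exact hG.not_isInner hw hloop hO (g4.absorb_two hK (a := 2) (d := 1) (by decide)
          (by decide) (h 2) (h 3) (h 0) (h 1) hr rfl) domino_inner_left
    · rw [hE] at g4
      have hL : ∀ i, innerLabel E ![τ 0, τ 1, τ 2, τ 3] ![(0 : Fin 4), 1, 3, 2] i = 0 →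
          i = 0 ∨ i = 2 := by
        intro i; rw [h]; revert i; decide
      -- Here the matching half-edges are `1` and `3`, on the other side of the cut, so the
      -- complement is used.
      rw [← cut_compl (wt_comm K)] at hz
      rcases g4.reachable_or (a := 1) (b := 0) (c := 3) (d := 2) hL hz (by simp [h1])
        (by simp [h0]) (by simp [h3]) (by simp [h2]) with hr | hr
      · exact hG.not_isInner hw hloop hO (g4.absorb_two hK (a := 1) (d := 2) (by decide)
          (by decide) (h 1) (h 0) (h 3) (h 2) hr rfl) domino_inner_right
      · exact hG.not_isInner hw hloop hO (g4.absorb_two hK (a := 3) (d := 0) (by decide)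
          (by decide) (h 3) (h 2) (h 1) (h 0) hr rfl) domino_inner_left

end Contradiction

/-! ### From a subgraph of a critical graph to a glued graph -/

section Extraction
open Finset

variable {V : Type u} {m n k : ℕ}

/-- `f` embeds the graph with edges `H` into `G`, as a not necessarily induced subgraph. -/
structure IsEmbedding (G : SimpleGraph V) (H : List (Fin n × Fin n)) (f : Fin n → V) : Prop where
  inj : Function.Injective f
  adj : ∀ e ∈ H, G.Adj (f e.1) (f e.2)

theorem IsEmbedding.adj_of_ne_zero {G : SimpleGraph V} {H : List (Fin n × Fin n)} {f : Fin n → V}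
    (hf : IsEmbedding G H f) {a b : Fin n} (h : listWt H a b ≠ 0) : G.Adj (f a) (f b) := by
  obtain ⟨e, he, ⟨rfl, rfl⟩ | ⟨rfl, rfl⟩⟩ := listWt_ne_zero.1 h
  · exact hf.adj e he
  · exact (hf.adj e he).symm

theorem IsEmbedding.cons {G : SimpleGraph V} {H : List (Fin n × Fin n)} {f : Fin n → V}
    (hf : IsEmbedding G H f) {a b : Fin n} (hab : G.Adj (f a) (f b)) :
    IsEmbedding G ((a, b) :: H) f :=
  ⟨hf.inj, List.forall_mem_cons.2 ⟨hab, hf.adj⟩⟩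

theorem IsEmbedding.comp {G : SimpleGraph V} {H : List (Fin n × Fin n)} {f : Fin n → V}
    (hf : IsEmbedding G H f) {H' : List (Fin m × Fin m)} (g : Fin m → Fin n)
    (hg : Function.Injective g) (h : ∀ e ∈ H', listWt H (g e.1) (g e.2) ≠ 0) :
    IsEmbedding G H' (f ∘ g) :=
  ⟨hf.inj.comp hg, fun e he => hf.adj_of_ne_zero (h e he)⟩

theorem IsEmbedding.listWt_le_wt {G : SimpleGraph V} {H : List (Fin n × Fin n)} {f : Fin n → V}
    (hf : IsEmbedding G H f) (hsimple : ∀ a b, listWt H a b ≤ 1) (a b : Fin n) :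
    listWt H a b ≤ wt G (f a) (f b) := by
  by_cases h : listWt H a b = 0
  · rw [h]; exact Nat.zero_le _
  · rw [wt_of_adj (hf.adj_of_ne_zero h)]; exact hsimple a b

variable [Fintype V]

/-- A vertex all of whose neighbours are known has no further neighbours. -/
theorem IsEmbedding.listWt_ne_zero_of_listDeg {G : SimpleGraph V} {H : List (Fin n × Fin n)}
    {f : Fin n → V} (hf : IsEmbedding G H f) (hG : IsCubicMultigraph (wt G))
    (hH : ∀ e ∈ H, e.1 ≠ e.2) (hsimple : ∀ a b, listWt H a b ≤ 1) {a b : Fin n}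
    (ha : listDeg H a = 3) (hab : G.Adj (f a) (f b)) : listWt H a b ≠ 0 := by
  classical
  intro h0
  have h1 : (∑ c, wt G (f a) (f c)) ≤ 3 := by
    rw [← hG.deg_eq (f a), deg, ← Finset.sum_image (f := fun v => wt G (f a) v)
      (fun _ _ _ _ h => hf.inj h)]
    exact Finset.sum_le_sum_of_subset (Finset.subset_univ _)
  have h2 : (∑ c, (listWt H a c + if c = b then 1 else 0)) ≤ ∑ c, wt G (f a) (f c) := by
    refine Finset.sum_le_sum fun c _ => ?_
    by_cases hc : c = b
    · subst hc; simp [h0, wt_of_adj hab]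
    · simpa [hc] using hf.listWt_le_wt hsimple a c
  rw [Finset.sum_add_distrib] at h2
  have h3 : ∑ c, listWt H a c = 3 := by rw [← ha, ← deg_listWt hH]; rfl
  simp [h3] at h2
  omega

/-- Vertices of degree 3 in `H` have no further edges, and `hind` forbids further edges among the
others. So the copy is induced, and each missing degree is one edge to the outside. -/
theorem IsCritical.exists_glue {G : SimpleGraph V} (hG : IsCritical G) {H : List (Fin n × Fin n)}
    {f : Fin n → V} (hf : IsEmbedding G H f) (hH : ∀ e ∈ H, e.1 ≠ e.2)
    (hsimple : ∀ a b, listWt H a b ≤ 1) {s : Fin k → Fin n} (hs : Function.Injective s)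
    (hdeg : ∀ a, pieceDeg H (fun _ => true) s a = 3)
    (hind : ∀ a b, a ≠ b → listWt H a b = 0 → listDeg H a ≠ 3 → listDeg H b ≠ 3 →
      ¬G.Adj (f a) (f b)) :
    ∃ (O : Type u) (_ : Fintype O) (K : SimpleGraph O) (o : Fin k → O)
      (G' : SimpleGraph (O ⊕ Fin n)), IsCritical G' ∧
      wt G' = glueWt (wt K) (listWt H) (fun _ => true) o s := by
  classical
  let O := {v : V // v ∉ Set.range f}
  have hbij : Function.Bijective (Sum.elim Subtype.val f : O ⊕ Fin n → V) := by
    constructor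
    · rintro (⟨u, hu⟩ | a) (⟨v, hv⟩ | b) h
      · exact congrArg Sum.inl (Subtype.ext h)
      · exact absurd ⟨b, h.symm⟩ hu
      · exact absurd ⟨a, h⟩ hv
      · simpa using hf.inj h
    · intro v
      by_cases hv : v ∈ Set.range f
      · obtain ⟨a, rfl⟩ := hv
        exact ⟨.inr a, rfl⟩
      · exact ⟨.inl ⟨v, hv⟩, rfl⟩
  set e := Equiv.ofBijective _ hbij
  set G' := G.comap e with hG'
  have hcrit : IsCritical G' := hG.comap e
  have hinner : ∀ a b, wt G' (.inr a) (.inr b) = listWt H a b := by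
    intro a b
    rw [hG', wt_comap]
    show wt G (f a) (f b) = _
    refine le_antisymm ?_ (hf.listWt_le_wt hsimple a b)
    by_cases h : G.Adj (f a) (f b)
    · have hne : a ≠ b := by rintro rfl; exact h.ne rfl
      rw [wt_of_adj h, Nat.one_le_iff_ne_zero]
      by_cases h1 : listDeg H a = 3
      · exact hf.listWt_ne_zero_of_listDeg hG.cubic hH hsimple h1 h
      · by_cases h2 : listDeg H b = 3
        · rw [listWt_comm]
          exact hf.listWt_ne_zero_of_listDeg hG.cubic hH hsimple h2 h.symm
        · exact fun h0 => hind a b hne h0 h1 h2 h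
    · rw [wt_of_not_adj h]; exact Nat.zero_le _
  have hout : ∀ a, ∑ u : O, wt G' (.inr a) (.inl u) = halfDeg (fun _ => true) s a := by
    intro a
    have h1 := hcrit.cubic.deg_eq (.inr a)
    rw [deg, Fintype.sum_sum_type] at h1
    have h2 : ∑ b, wt G' (.inr a) (.inr b) = listDeg H a := by
      rw [← deg_listWt hH]; exact Finset.sum_congr rfl fun b _ => hinner a b
    have h3 := hdeg a
    unfold pieceDeg at h3
    omega
  have hhalf : ∀ i, halfDeg (fun _ => true) s (s i) = 1 := by
    intro i
    rw [halfDeg_eq, halves, Finset.sum_eq_single i]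
    · simp
    · intro j _ hj; simp [hs.ne hj]
    · simp
  have hex : ∀ i, ∃ u : O, G'.Adj (.inr (s i)) (.inl u) := by
    intro i
    by_contra hcon
    push Not at hcon
    have := hout (s i)
    rw [hhalf, Finset.sum_eq_zero fun u _ => wt_of_not_adj (hcon u)] at this
    omega
  choose o ho using hex
  have huniq : ∀ i u, G'.Adj (.inr (s i)) (.inl u) → u = o i := by
    intro i u hu
    by_contra hne
    have := hout (s i)
    have h2 : 2 ≤ ∑ u : O, wt G' (.inr (s i)) (.inl u) := by
      refine le_trans ?_ (Finset.sum_le_sum_of_subset (Finset.subset_univ {u, o i}))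
      rw [Finset.sum_pair hne, wt_of_adj hu, wt_of_adj (ho i)]
    rw [hhalf] at this
    omega
  have hmix : ∀ (u : O) a, wt G' (.inl u) (.inr a) =
      glueWt (wt (G'.comap Sum.inl)) (listWt H) (fun _ => true) o s (.inl u) (.inr a) := by
    intro u a
    simp only [glueWt, true_and]
    by_cases ha : ∃ i, s i = a
    · obtain ⟨i, rfl⟩ := ha
      rw [Finset.sum_eq_single i]
      · by_cases h : o i = u
        · subst h; simp [wt_of_adj (ho i).symm]
        · rw [wt_of_not_adj fun h' => h (huniq i u h'.symm).symm]; simp [h]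
      · intro j _ hj; simp [hs.ne hj]
      · simp
    · push Not at ha
      rw [Finset.sum_eq_zero fun i _ => if_neg fun h => ha i h.2, wt_comm]
      have h0 : halfDeg (fun _ => true) s a = 0 := by
        rw [halfDeg_eq, halves]
        exact Finset.sum_eq_zero fun i _ => if_neg fun h => ha i h.2
      exact (Finset.sum_eq_zero_iff.1 ((hout a).trans h0)) u (Finset.mem_univ u)
  refine ⟨O, inferInstance, G'.comap Sum.inl, o, G', hcrit, ?_⟩
  ext x y
  rcases x with u | a <;> rcases y with v | b
  · simp only [glueWt]
    by_cases h : G'.Adj (.inl u) (.inl v) <;> simp [wt, h]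
  · exact hmix u b
  · rw [wt_comm, hmix v a]; rfl
  · exact hinner a b

variable {G : SimpleGraph V}

theorem IsCritical.triangle_free (hG : IsCritical G) {a b c : V} (hab : G.Adj a b)
    (hbc : G.Adj b c) (hac : G.Adj a c) : False := by
  have hf : IsEmbedding G triangleEdges ![a, b, c] := by
    constructor
    · have := hab.ne; have := hbc.ne; have := hac.ne
      intro i j
      fin_cases i <;> fin_cases j <;> simp_all [eq_comm]
    · simp [triangleEdges, hab, hbc, hac]
  obtain ⟨O, _, K, o, G', h1, h2⟩ := hG.exists_glue hf (s := ![0, 1, 2]) (by decide +kernel) (by decide +kernel)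
    (by decide +kernel) (by decide +kernel) fun a b hab h0 => absurd h0 (by revert a b; decide +kernel)
  exact h1.false_of_contract h2 (by norm_num) (by decide +kernel) triangle_realizable

/-- If two nonadjacent vertices of a piece have a common neighbour, then they are also nonadjacent
in a triangle-free host. -/
theorem IsCritical.not_adj_of_common (hG : IsCritical G) {H : List (Fin n × Fin n)} {f : Fin n → V}
    (hf : IsEmbedding G H f) {a b : Fin n} (h : ∃ c, listWt H a c ≠ 0 ∧ listWt H c b ≠ 0) :
    ¬G.Adj (f a) (f b) := fun hab => by
  obtain ⟨c, h1, h2⟩ := h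
  exact hG.triangle_free (hf.adj_of_ne_zero h1) (hf.adj_of_ne_zero h2) hab

theorem IsCritical.not_isEmbedding_k23 (hG : IsCritical G) (f : Fin 5 → V) :
    ¬IsEmbedding G k23Edges f := fun hf => by
  obtain ⟨O, _, K, o, G', h1, h2⟩ := hG.exists_glue hf (s := ![2, 3, 4]) (by decide +kernel) (by decide +kernel)
    (by decide +kernel) (by decide +kernel) fun a b hab h0 _ _ =>
      hG.not_adj_of_common hf (by revert a b; decide +kernel)
  exact h1.false_of_contract h2 (by norm_num) (by decide +kernel) k23_realizable

theorem IsCritical.not_isEmbedding_twinHouse (hG : IsCritical G) (f : Fin 6 → V) :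
    ¬IsEmbedding G twinHouseEdges f := fun hf => by
  obtain ⟨O, _, K, o, G', h1, h2⟩ := hG.exists_glue hf (s := ![0, 1, 2, 3]) (by decide +kernel)
    (by decide +kernel) (by decide +kernel) (by decide +kernel) fun a b hab h0 ha hb =>
      hG.not_adj_of_common hf (by revert a b; decide +kernel)
  exact h1.false_of_square h2 (by norm_num) (by decide +kernel) (by decide +kernel) twinHouse_realizable

theorem IsCritical.not_isEmbedding_clawSquare (hG : IsCritical G) (f : Fin 8 → V) :
    ¬IsEmbedding G clawSquareEdges f := fun hf => by
  -- This edge would complete a `K_{2,3}` with sides `{1, 3}` and `{0, 2, 5}`.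
  have h35 : ¬G.Adj (f 3) (f 5) := fun h =>
    hG.not_isEmbedding_k23 _ ((hf.cons h).comp ![1, 3, 0, 2, 5] (by decide +kernel) (by decide +kernel))
  obtain ⟨O, _, K, o, G', h1, h2⟩ := hG.exists_glue hf (s := ![3, 4, 5, 6]) (by decide +kernel)
    (by decide +kernel) (by decide +kernel) (by decide +kernel) fun a b hab h0 ha hb => by
      have key : ∀ a b : Fin 8, a ≠ b → listWt clawSquareEdges a b = 0 →
        listDeg clawSquareEdges a ≠ 3 → listDeg clawSquareEdges b ≠ 3 →
        (∃ c, listWt clawSquareEdges a c ≠ 0 ∧ listWt clawSquareEdges c b ≠ 0) ∨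
        (a = 3 ∧ b = 5) ∨ (a = 5 ∧ b = 3) := by decide +kernel
      rcases key a b hab h0 ha hb with h | ⟨rfl, rfl⟩ | ⟨rfl, rfl⟩
      · exact hG.not_adj_of_common hf h
      · exact h35
      · exact fun h => h35 h.symm
  exact h1.false_of_square h2 (by norm_num) (t := ![0, 1, 2, 3]) (by decide) (by decide +kernel)
    clawSquare_realizable

theorem IsCritical.not_isEmbedding_domino (hG : IsCritical G) (f : Fin 6 → V) :
    ¬IsEmbedding G dominoEdges f := fun hf => by
  -- This edge would complete a `K_{2,3}` with sides `{0, 5}` and `{1, 4, 3}`; the next claim is its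
  -- mirror image.
  have h03 : ¬G.Adj (f 0) (f 3) := fun h =>
    hG.not_isEmbedding_k23 _ ((hf.cons h).comp ![0, 5, 1, 4, 3] (by decide +kernel) (by decide +kernel))
  have h12 : ¬G.Adj (f 1) (f 2) := fun h =>
    hG.not_isEmbedding_k23 _ ((hf.cons h).comp ![1, 4, 0, 5, 2] (by decide +kernel) (by decide +kernel))
  obtain ⟨O, _, K, o, G', h1, h2⟩ := hG.exists_glue hf (s := ![0, 1, 2, 3]) (by decide +kernel)
    (by decide +kernel) (by decide +kernel) (by decide +kernel) fun a b hab h0 ha hb => by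
      have key : ∀ a b : Fin 6, a ≠ b → listWt dominoEdges a b = 0 →
        listDeg dominoEdges a ≠ 3 → listDeg dominoEdges b ≠ 3 →
        (∃ c, listWt dominoEdges a c ≠ 0 ∧ listWt dominoEdges c b ≠ 0) ∨
        (a = 0 ∧ b = 3) ∨ (a = 3 ∧ b = 0) ∨ (a = 1 ∧ b = 2) ∨ (a = 2 ∧ b = 1) := by decide +kernel
      rcases key a b hab h0 ha hb with h | ⟨rfl, rfl⟩ | ⟨rfl, rfl⟩ | ⟨rfl, rfl⟩ | ⟨rfl, rfl⟩
      · exact hG.not_adj_of_common hf h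
      · exact h03
      · exact fun h => h03 h.symm
      · exact h12
      · exact fun h => h12 h.symm
  exact h1.false_of_domino h2

theorem IsCritical.not_isEmbedding_petersen (hG : IsCritical G) (f : Fin 9 → V) :
    ¬IsEmbedding G petersenEdges f := fun hf => by
  classical
  obtain ⟨O, _, K, o, G', h1, h2⟩ := hG.exists_glue hf (s := ![0, 3, 4]) (by decide +kernel)
    (by decide +kernel) (by decide +kernel) (by decide +kernel) fun a b hab h0 ha hb hadj => by
      -- With an additional edge, the degrees inside the copy sum to at least 26 out of 27, so at
      -- most one edge leaves it. Hence the copy is the whole graph, but no cubic graph has nine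
      -- vertices.
      have hsum : ∀ c, (listDeg petersenEdges c + ((if c = a then 1 else 0) +
          if c = b then 1 else 0)) ≤ ∑ d, wt G (f c) (f d) := by
        intro c
        rw [← deg_listWt (by decide +kernel)]
        have e : ∀ x y : Fin 9, (if c = x then 1 else 0) =
            ∑ d, if c = x ∧ d = y then 1 else 0 := by
          intro x y; by_cases h : c = x <;> simp [h]
        rw [e a b, e b a, deg, ← Finset.sum_add_distrib, ← Finset.sum_add_distrib]
        refine Finset.sum_le_sum fun d _ => ?_
        by_cases h3 : c = a ∧ d = b
        · obtain ⟨rfl, rfl⟩ := h3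
          simp [h0, wt_of_adj hadj, hab]
        · by_cases h4 : c = b ∧ d = a
          · obtain ⟨rfl, rfl⟩ := h4
            rw [listWt_comm] at h0
            simp [h0, wt_of_adj hadj.symm, hab.symm]
          · simpa [h3, h4] using hf.listWt_le_wt (by decide +kernel) c d
      have htot := Finset.sum_le_sum fun c (_ : c ∈ univ) => hsum c
      rw [Finset.sum_add_distrib, sum_listDeg (by decide +kernel), Finset.sum_add_distrib] at htot
      simp only [Finset.sum_ite_eq', Finset.mem_univ, if_true] at htot
      have hlen : petersenEdges.length = 12 := rfl
      set z : V → Bool := fun v => decide (v ∈ Finset.univ.image f) with hz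
      have hcut : cut (wt G) z + ∑ c, ∑ d, wt G (f c) (f d) = 27 := by
        have e1 : cut (wt G) z = ∑ c, ∑ v, if z v then 0 else wt G (f c) v := by
          rw [← Finset.sum_image (s := univ) (g := f)
            (f := fun u => ∑ v, if z v then 0 else wt G u v) (fun _ _ _ _ h => hf.inj h), cut,
            ← Finset.sum_subset (Finset.subset_univ (univ.image f))]
          · refine Finset.sum_congr rfl fun u hu => Finset.sum_congr rfl fun v _ => ?_
            have : z u = true := by simpa [hz] using hu
            cases hv : z v <;> simp [this]
          · intro u _ hu
            have : z u = false := by simpa [hz] using hu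
            simp [this]
        have e2 : ∀ c, ∑ d, wt G (f c) (f d) = ∑ v, if z v then wt G (f c) v else 0 := by
          intro c
          rw [← Finset.sum_image (s := univ) (g := f) (f := fun v => wt G (f c) v)
            (fun _ _ _ _ h => hf.inj h), ← Finset.sum_filter]
          congr 1
          ext v; simp [hz]
        rw [e1, ← Finset.sum_add_distrib]
        have e3 : ∀ c, (∑ v, if z v then 0 else wt G (f c) v) + ∑ d, wt G (f c) (f d) = 3 := by
          intro c
          rw [e2, ← Finset.sum_add_distrib, ← hG.cubic.deg_eq (f c)]
          refine Finset.sum_congr rfl fun v _ => ?_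
          split_ifs <;> simp
        simp [e3]
      by_cases hsurj : ∃ v, z v = false
      · have := hG.cubic.three_le_cut z ⟨f 0, by simp [hz]⟩ hsurj
        omega
      · push Not at hsurj
        have hcard : Fintype.card V = 9 := by
          have : Function.Bijective f := ⟨hf.inj, fun v => by simpa [hz] using hsurj v⟩
          simpa using (Fintype.card_of_bijective this).symm
        have h3 := G.sum_degrees_eq_twice_card_edges
        simp only [← deg_wt, hG.cubic.deg_eq, Finset.sum_const, Finset.card_univ, hcard] at h3
        simp at h3
        omega
  exact h1.false_of_petersen h2

end Extraction

/-! ### Chords of short cycles, and induced paths on six vertices -/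

section Consequences

variable {V : Type u} {G : SimpleGraph V}

/-- There is no induced path on six vertices whose centre edge is `ab`. -/
def NoPath (G : SimpleGraph V) (a b : V) : Prop :=
  ∀ x p q y, G.Adj p a → G.Adj q b → G.Adj x p → G.Adj y q → x ≠ a → y ≠ b → p ≠ b → q ≠ a →
    ¬G.Adj p q → ¬G.Adj x b → ¬G.Adj y a → ¬G.Adj x q → ¬G.Adj y p → ¬G.Adj x y → False

theorem NoPath.symm {a b : V} (h : NoPath G a b) : NoPath G b a :=
  fun x p q y h1 h2 h3 h4 h5 h6 h7 h8 h9 h10 h11 h12 h13 h14 =>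
    h y q p x h2 h1 h4 h3 h6 h5 h8 h7 (fun h => h9 h.symm) h11 h10 h13 h12 fun h => h14 h.symm

variable [Fintype V]

theorem IsCritical.ncard_neighborSet (hG : IsCritical G) (v : V) : (G.neighborSet v).ncard = 3 := by
  rw [← deg_wt_eq_ncard]; exact hG.cubic.deg_eq v

theorem IsCritical.eq_of_adj (hG : IsCritical G) {v x y z w : V} (hx : G.Adj v x) (hy : G.Adj v y)
    (hz : G.Adj v z) (hxy : x ≠ y) (hxz : x ≠ z) (hyz : y ≠ z) (hw : G.Adj v w) :
    w = x ∨ w = y ∨ w = z := by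
  have h1 : ({x, y, z} : Set V).ncard = 3 := Set.ncard_eq_three.2 ⟨x, y, z, hxy, hxz, hyz, rfl⟩
  have h2 : ({x, y, z} : Set V) = G.neighborSet v := by
    refine Set.eq_of_subset_of_ncard_le ?_ (by rw [h1, hG.ncard_neighborSet]) (Set.toFinite _)
    rintro u (rfl | rfl | rfl) <;> assumption
  have h3 : w ∈ ({x, y, z} : Set V) := h2 ▸ hw
  simpa using h3

theorem IsCritical.exists_nbrs (hG : IsCritical G) {v u : V} (h : G.Adj v u) :
    ∃ x y, G.Adj v x ∧ G.Adj v y ∧ x ≠ y ∧ x ≠ u ∧ y ≠ u := by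
  obtain ⟨x, y, z, hxy, hxz, hyz, hs⟩ := Set.ncard_eq_three.1 (hG.ncard_neighborSet v)
  have h1 : ∀ w, G.Adj v w ↔ w = x ∨ w = y ∨ w = z := fun w => by
    rw [← SimpleGraph.mem_neighborSet, hs]; simp
  rcases (h1 u).1 h with rfl | rfl | rfl
  · exact ⟨y, z, by simp [h1], by simp [h1], hyz, hxy.symm, hxz.symm⟩
  · exact ⟨x, z, by simp [h1], by simp [h1], hxz, hxy, hyz.symm⟩
  · exact ⟨x, y, by simp [h1], by simp [h1], hxy, hxz, hyz⟩

theorem IsCritical.no_k23 (hG : IsCritical G) {x y a b c : V} (h02 : G.Adj x a) (h03 : G.Adj x b)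
    (h04 : G.Adj x c) (h12 : G.Adj y a) (h13 : G.Adj y b) (h14 : G.Adj y c) (hxy : x ≠ y)
    (hab : a ≠ b) (hac : a ≠ c) (hbc : b ≠ c) : False := by
  refine hG.not_isEmbedding_k23 ![x, y, a, b, c] ⟨?_, ?_⟩
  · have := h02.ne; have := h03.ne; have := h04.ne; have := h12.ne; have := h13.ne; have := h14.ne
    intro i j h
    fin_cases i <;> fin_cases j <;> simp_all [eq_comm]
  · simp [k23Edges, *]

theorem IsCritical.no_twinHouse (hG : IsCritical G) {v₀ v₁ v₂ v₃ v₄ v₅ : V} (h01 : G.Adj v₀ v₁)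
    (h04 : G.Adj v₀ v₄) (h15 : G.Adj v₁ v₅) (h42 : G.Adj v₄ v₂) (h43 : G.Adj v₄ v₃)
    (h52 : G.Adj v₅ v₂) (h53 : G.Adj v₅ v₃) (n02 : v₀ ≠ v₂) (n03 : v₀ ≠ v₃) (n12 : v₁ ≠ v₂)
    (n13 : v₁ ≠ v₃) (n23 : v₂ ≠ v₃) (n45 : v₄ ≠ v₅) : False := by
  have n05 : v₀ ≠ v₅ := by rintro rfl; exact hG.triangle_free h04 h42 h52
  have n14 : v₁ ≠ v₄ := by rintro rfl; exact hG.triangle_free h15 h52 h42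
  refine hG.not_isEmbedding_twinHouse ![v₀, v₁, v₂, v₃, v₄, v₅] ⟨?_, ?_⟩
  · have := h01.ne; have := h04.ne; have := h15.ne; have := h42.ne; have := h43.ne
    have := h52.ne; have := h53.ne
    intro i j h
    fin_cases i <;> fin_cases j <;> simp_all [eq_comm]
  · simp [twinHouseEdges, *]

theorem IsCritical.no_domino (hG : IsCritical G) {v₀ v₁ v₂ v₃ v₄ v₅ : V} (h01 : G.Adj v₀ v₁)
    (h04 : G.Adj v₀ v₄) (h15 : G.Adj v₁ v₅) (h45 : G.Adj v₄ v₅) (h42 : G.Adj v₄ v₂)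
    (h53 : G.Adj v₅ v₃) (h23 : G.Adj v₂ v₃) (n05 : v₀ ≠ v₅) (n02 : v₀ ≠ v₂) (n52 : v₅ ≠ v₂)
    (n14 : v₁ ≠ v₄) (n13 : v₁ ≠ v₃) (n43 : v₄ ≠ v₃) : False := by
  have n03 : v₀ ≠ v₃ := by rintro rfl; exact hG.triangle_free h01 h15 h53.symm
  have n12 : v₁ ≠ v₂ := by rintro rfl; exact hG.triangle_free h42 h15 h45
  refine hG.not_isEmbedding_domino ![v₀, v₁, v₂, v₃, v₄, v₅] ⟨?_, ?_⟩
  · have := h01.ne; have := h04.ne; have := h15.ne; have := h45.ne; have := h42.ne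
    have := h53.ne; have := h23.ne
    intro i j h
    fin_cases i <;> fin_cases j <;> simp_all [eq_comm]
  · simp [dominoEdges, *]

/-- A closed walk `p` of length `4`, `5` or `6` without repeated vertices has no chords. -/
theorem IsCritical.no_chord (hG : IsCritical G) {p : ℕ → V} {l : ℕ} (hl : l = 4 ∨ l = 5 ∨ l = 6)
    (hadj : ∀ i < l, G.Adj (p i) (p (i + 1))) (hclosed : p l = p 0)
    (hinj : ∀ i < l, ∀ j < l, p i = p j → i = j) {i j : ℕ} (hij : i < j) (hj : j < l)
    (h : G.Adj (p i) (p j)) : j = i + 1 ∨ (i = 0 ∧ j + 1 = l) := by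
  by_contra hcon
  push Not at hcon
  have hl1 : G.Adj (p (l - 1)) (p 0) := by
    have := hadj (l - 1) (by omega)
    rwa [Nat.sub_add_cancel (by omega), hclosed] at this
  have hl2 : G.Adj (p (l - 2)) (p (l - 1)) := by
    have := hadj (l - 2) (by omega)
    rwa [show l - 2 + 1 = l - 1 by omega] at this
  have hshort : j ≠ i + 2 := by
    rintro rfl
    exact hG.triangle_free (hadj i (by omega)) (hadj (i + 1) (by omega)) h
  have hi : i ≤ 2 := by omega
  have h01 := hadj 0 (by omega)
  have hlong : ¬(i = 0 ∧ j = l - 2) := by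
    rintro ⟨rfl, rfl⟩
    exact hG.triangle_free hl2 hl1 h.symm
  have hlong' : ¬(i = 1 ∧ j = l - 1) := by
    rintro ⟨rfl, rfl⟩
    exact hG.triangle_free hl1 h01 h.symm
  -- A chord that cuts off no triangle is a long diagonal of a hexagon, and makes it a domino.
  obtain rfl : l = 6 := by omega
  obtain rfl : j = i + 3 := by omega
  have h12 := hadj 1 (by omega)
  have h23 := hadj 2 (by omega)
  have h34 := hadj 3 (by omega)
  have h45 := hadj 4 (by omega)
  simp only [Nat.reduceAdd, Nat.reduceSub] at h01 h12 h23 h34 h45 hl1 h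
  have hne : ∀ i < 6, ∀ j < 6, i ≠ j → p i ≠ p j := fun i hi j hj hij h => hij (hinj i hi j hj h)
  interval_cases i
  · refine hG.no_domino h12 h01.symm h23 h hl1.symm h34 h45.symm ?_ ?_ ?_ ?_ ?_ ?_ <;>
      exact hne _ (by norm_num) _ (by norm_num) (by norm_num)
  · refine hG.no_domino h23 h12.symm h34 h h01.symm h45 hl1.symm ?_ ?_ ?_ ?_ ?_ ?_ <;>
      exact hne _ (by norm_num) _ (by norm_num) (by norm_num)
  · refine hG.no_domino h34 h23.symm h45 h h12.symm hl1 h01.symm ?_ ?_ ?_ ?_ ?_ ?_ <;>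
      exact hne _ (by norm_num) _ (by norm_num) (by norm_num)

theorem IsCritical.isInduced_toSubgraph (hG : IsCritical G) {v : V} {c : G.Walk v v}
    (hc : c.IsCycle) (hl : c.length = 4 ∨ c.length = 5 ∨ c.length = 6) :
    c.toSubgraph.IsInduced := by
  have hadj : ∀ i < c.length, G.Adj (c.getVert i) (c.getVert (i + 1)) :=
    fun i hi => c.adj_getVert_succ hi
  have hclosed : c.getVert c.length = c.getVert 0 := by simp
  have hinj : ∀ i < c.length, ∀ j < c.length, c.getVert i = c.getVert j → i = j := by
    intro i hi j hj h
    exact hc.getVert_injOn' (by simp; omega) (by simp; omega) h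
  have key : ∀ i < c.length, ∀ j < c.length, i < j → G.Adj (c.getVert i) (c.getVert j) →
      c.toSubgraph.Adj (c.getVert i) (c.getVert j) := by
    intro i hi j hj hij h
    rcases hG.no_chord hl hadj hclosed hinj hij hj h with rfl | ⟨rfl, hjl⟩
    · exact c.toSubgraph_adj_getVert hi
    · have := c.toSubgraph_adj_getVert hj
      rw [hjl, hclosed] at this
      exact this.symm
  have hmem : ∀ u ∈ c.toSubgraph.verts, ∃ i < c.length, c.getVert i = u := by
    intro u hu
    rw [SimpleGraph.Walk.mem_verts_toSubgraph, SimpleGraph.Walk.mem_support_iff_exists_getVert] at hu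
    obtain ⟨i, rfl, hi⟩ := hu
    rcases hi.lt_or_eq with hi | rfl
    · exact ⟨i, hi, rfl⟩
    · exact ⟨0, by omega, hclosed.symm⟩
  intro x hx y hy hxy
  obtain ⟨i, hi, rfl⟩ := hmem x hx
  obtain ⟨j, hj, rfl⟩ := hmem y hy
  rcases lt_trichotomy i j with hij | rfl | hij
  · exact key i hi j hj hij hxy
  · exact absurd rfl hxy.ne
  · exact (key j hj i hi hij hxy.symm).symm

theorem IsCritical.four_le_egirth (hG : IsCritical G) : 4 ≤ G.egirth := by
  rw [SimpleGraph.le_egirth]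
  intro v c hc
  have h3 := hc.three_le_length
  suffices c.length ≠ 3 by
    have : 4 ≤ c.length := by omega
    exact_mod_cast this
  intro hl
  have h0 := c.adj_getVert_succ (i := 0) (by omega)
  have h1 := c.adj_getVert_succ (i := 1) (by omega)
  have h2 := c.adj_getVert_succ (i := 2) (by omega)
  have h4 : c.getVert 3 = c.getVert 0 := by rw [← hl]; simp
  rw [show 2 + 1 = 3 from rfl, h4] at h2
  exact hG.triangle_free h0 h1 h2.symm

/-- The second neighbourhoods along an edge that is not the centre of an induced path `P₆`. -/
theorem IsCritical.exists_common (hG : IsCritical G) {a b p q : V} (hab : G.Adj a b)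
    (hno : NoPath G a b) (hpa : G.Adj p a) (hqb : G.Adj q b) (hpb : p ≠ b) (hqa : q ≠ a)
    (hpq : ¬G.Adj p q) (hp : ∀ w, G.Adj p w → G.Adj w b → w = a)
    (hq : ∀ w, G.Adj q w → G.Adj w a → w = b) :
    ∃ z x y, G.Adj p z ∧ G.Adj q z ∧ G.Adj p x ∧ G.Adj q y ∧ G.Adj x y ∧ z ≠ a ∧ z ≠ b ∧ x ≠ a ∧
      y ≠ b ∧ x ≠ z ∧ y ≠ z := by
  have tri : ∀ {u v w : V}, G.Adj u v → G.Adj v w → ¬G.Adj u w :=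
    fun h1 h2 h3 => hG.triangle_free h1 h2 h3
  have hpq' : p ≠ q := by rintro rfl; exact tri hpa.symm hqb hab
  -- Otherwise `x p a b q y` would be an induced path.
  have main : ∀ x y, G.Adj p x → x ≠ a → G.Adj q y → y ≠ b → ¬G.Adj q x → ¬G.Adj p y → G.Adj x y := by
    intro x y hpx hxa hqy hyb hqx hpy
    by_contra hxy
    exact hno x p q y hpa hqb hpx.symm hqy.symm hxa hyb hpb hqa hpq (fun h => hxa (hp x hpx h))
      (fun h => hyb (hq y hqy h)) (fun h => hqx h.symm) (fun h => hpy h.symm) hxy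
  obtain ⟨x₁, x₂, hx₁, hx₂, hx, hx₁a, hx₂a⟩ := hG.exists_nbrs hpa
  obtain ⟨y₁, y₂, hy₁, hy₂, hy, hy₁b, hy₂b⟩ := hG.exists_nbrs hqb
  have hxb : ∀ x, G.Adj p x → x ≠ b := by rintro x hx rfl; exact tri hpa hab hx
  have hya : ∀ y, G.Adj q y → y ≠ a := by rintro x hx rfl; exact tri hqb hab.symm hx
  have one : ∀ z x, G.Adj p z → z ≠ a → G.Adj p x → x ≠ a → x ≠ z → G.Adj q z → ¬G.Adj q x →
      ∃ z x y, G.Adj p z ∧ G.Adj q z ∧ G.Adj p x ∧ G.Adj q y ∧ G.Adj x y ∧ z ≠ a ∧ z ≠ b ∧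
        x ≠ a ∧ y ≠ b ∧ x ≠ z ∧ y ≠ z := by
    intro z x hpz hza hpx hxa hxz hqz hqx
    obtain ⟨y, hqy, hyb, hyz⟩ : ∃ y, G.Adj q y ∧ y ≠ b ∧ y ≠ z := by
      by_cases h : y₁ = z
      · exact ⟨y₂, hy₂, hy₂b, fun h' => hy (h.trans h'.symm)⟩
      · exact ⟨y₁, hy₁, hy₁b, h⟩
    refine ⟨z, x, y, hpz, hqz, hpx, hqy, main x y hpx hxa hqy hyb hqx fun hpy => ?_, hza,
      hxb z hpz, hxa, hyb, hxz, hyz⟩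
    rcases hG.eq_of_adj hpa hpz hpx hza.symm hxa.symm hxz.symm hpy with h | h | h
    · exact hya y hqy h
    · exact hyz h
    · exact hqx (h ▸ hqy)
  -- Two common neighbours of `p` and `q` besides `a` and `b` give a twin-house. None gives a
  -- `K_{2,3}` with sides `{x₁, x₂}` and `{p, y₁, y₂}`. So there is exactly one.
  by_cases h1 : G.Adj q x₁ <;> by_cases h2 : G.Adj q x₂
  · exact (hG.no_twinHouse hab hpa.symm hqb.symm hx₁ hx₂ h1 h2 hx₁a.symm hx₂a.symm (hxb _ hx₁).symm
      (hxb _ hx₂).symm hx hpq').elim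
  · exact one x₁ x₂ hx₁ hx₁a hx₂ hx₂a hx.symm h1 h2
  · exact one x₂ x₁ hx₂ hx₂a hx₁ hx₁a hx h2 h1
  · have hpy : ∀ y, G.Adj q y → ¬G.Adj p y := by
      intro y hqy hpy
      rcases hG.eq_of_adj hpa hx₁ hx₂ hx₁a.symm hx₂a.symm hx hpy with h | h | h
      · exact hya y hqy h
      · exact h1 (h ▸ hqy)
      · exact h2 (h ▸ hqy)
    exact (hG.no_k23 hx₁.symm (main _ _ hx₁ hx₁a hy₁ hy₁b h1 (hpy _ hy₁))
      (main _ _ hx₁ hx₁a hy₂ hy₂b h1 (hpy _ hy₂)) hx₂.symm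
      (main _ _ hx₂ hx₂a hy₁ hy₁b h2 (hpy _ hy₁)) (main _ _ hx₂ hx₂a hy₂ hy₂b h2 (hpy _ hy₂)) hx
      (fun h => hpq (h ▸ hy₁.symm)) (fun h => hpq (h ▸ hy₂.symm)) hy).elim

/-- The third neighbour of `p₁`, if `a b q₁ p₁` is a square. -/
theorem IsCritical.adj_of_square (hG : IsCritical G) {a b p₁ p₂ q₁ q₂ z x y : V}
    (hab : G.Adj a b) (hno : NoPath G a b) (hp₁ : G.Adj p₁ a) (hp₂ : G.Adj p₂ a)
    (hq₁ : G.Adj q₁ b) (hq₂ : G.Adj q₂ b) (hp : p₁ ≠ p₂) (hq : q₁ ≠ q₂) (hp₁b : p₁ ≠ b)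
    (hp₂b : p₂ ≠ b) (hq₁a : q₁ ≠ a) (hq₂a : q₂ ≠ a) (h11 : G.Adj p₁ q₁) (h12 : ¬G.Adj p₁ q₂)
    (h22 : ¬G.Adj p₂ q₂) (hpz : G.Adj p₂ z) (hqz : G.Adj q₂ z)
    (hpx : G.Adj p₂ x) (hqy : G.Adj q₂ y) (hxy : G.Adj x y) (hza : z ≠ a) (hzb : z ≠ b)
    (hyb : y ≠ b) (hyz : y ≠ z) : G.Adj p₁ y := by
  have tri : ∀ {u v w : V}, G.Adj u v → G.Adj v w → ¬G.Adj u w :=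
    fun h1 h2 h3 => hG.triangle_free h1 h2 h3
  obtain ⟨u, v, hu, hv, huv, hua, hva⟩ := hG.exists_nbrs hp₁
  obtain ⟨w, hw, hwa, hwq⟩ : ∃ w, G.Adj p₁ w ∧ w ≠ a ∧ w ≠ q₁ := by
    by_cases h : u = q₁
    · exact ⟨v, hv, hva, fun h' => huv (h.trans h'.symm)⟩
    · exact ⟨u, hu, hua, h⟩
  have hp₁n : ∀ {t}, G.Adj p₁ t → t = a ∨ t = q₁ ∨ t = w :=
    hG.eq_of_adj hp₁ h11 hw hq₁a.symm hwa.symm hwq.symm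
  have hz1 : z ≠ q₁ := by rintro rfl; exact tri hqz hq₁ hq₂
  have hwz : w ≠ z := by
    rintro rfl
    exact hG.no_domino hpz hp₂ hw.symm hp₁.symm hab h11 hq₁.symm hp.symm hp₂b hp₁b hza hz1
      hq₁a.symm
  by_contra hwy
  have hwb : ¬G.Adj w b := by
    intro h
    rcases hG.eq_of_adj hab.symm hq₁.symm hq₂.symm hq₁a.symm hq₂a.symm hq h.symm with h | h | h
    · exact hwa h
    · exact hwq h
    · exact h12 (h ▸ hw)
  have hwq₂ : ¬G.Adj w q₂ := by
    intro h
    rcases hG.eq_of_adj hq₂ hqz hqy hzb.symm hyb.symm hyz.symm h.symm with h | h | h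
    · exact tri hab.symm hp₁.symm (h ▸ hw.symm)
    · exact hwz h
    · exact hwy (h ▸ hw)
  have hnb : ∀ t, G.Adj q₂ t → t ≠ b → ¬G.Adj t a := by
    intro t ht htb h
    rcases hG.eq_of_adj hab hp₁.symm hp₂.symm hp₁b.symm hp₂b.symm hp h.symm with h | h | h
    · exact htb h
    · exact h12 (h ▸ ht.symm)
    · exact h22 (h ▸ ht.symm)
  -- Otherwise `w p₁ a b q₂ t` would be an induced path.
  have hadj : ∀ t, G.Adj q₂ t → t ≠ b → ¬G.Adj t p₁ → G.Adj w t := by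
    intro t ht htb htp
    by_contra h
    exact hno w p₁ q₂ t hp₁ hq₂ hw.symm ht.symm hwa htb hp₁b hq₂a h12 hwb (hnb t ht htb) hwq₂ htp h
  have hwz' : G.Adj w z := hadj z hqz hzb fun h => by
    rcases hp₁n h.symm with h | h | h
    · exact hza h
    · exact hz1 h
    · exact hwz h.symm
  have hwy' : G.Adj w y := hadj y hqy hyb fun h => hwy h.symm
  -- The square is `y q₂ z w`, and the additional path is `y x p₂ z`.
  refine hG.no_twinHouse hpx.symm hxy hpz hqy.symm hwy'.symm hqz.symm hwz'.symm ?_ ?_ ?_ ?_ ?_ hyz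
  · rintro rfl; exact h22 hpx
  · rintro rfl; exact tri hpz hwz'.symm hpx
  · rintro rfl; exact tri hp₂ hab hq₂
  · rintro rfl; exact tri hw hp₂ hp₁
  · rintro rfl; exact h12 hw

/-- If `ab` is not the centre of an induced path `P₆`, then it is in no square. -/
theorem IsCritical.not_adj_of_noPath (hG : IsCritical G) {a b p₁ p₂ q₁ q₂ : V}
    (hab : G.Adj a b) (hno : NoPath G a b) (hp₁ : G.Adj p₁ a) (hp₂ : G.Adj p₂ a)
    (hq₁ : G.Adj q₁ b) (hq₂ : G.Adj q₂ b) (hp : p₁ ≠ p₂) (hq : q₁ ≠ q₂) (hp₁b : p₁ ≠ b)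
    (hp₂b : p₂ ≠ b) (hq₁a : q₁ ≠ a) (hq₂a : q₂ ≠ a) : ¬G.Adj p₁ q₁ := by
  intro h11
  have tri : ∀ {u v w : V}, G.Adj u v → G.Adj v w → ¬G.Adj u w :=
    fun h1 h2 h3 => hG.triangle_free h1 h2 h3
  have h12 : ¬G.Adj p₁ q₂ := fun h =>
    hG.no_k23 hp₁ h11 h hab.symm hq₁.symm hq₂.symm hp₁b hq₁a.symm hq₂a.symm hq
  have h21 : ¬G.Adj p₂ q₁ := fun h =>
    hG.no_k23 hq₁ h11.symm h.symm hab hp₁.symm hp₂.symm hq₁a hp₁b.symm hp₂b.symm hp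
  have hpq₁ : p₂ ≠ q₁ := by rintro rfl; exact tri h11 hp₂ hp₁
  have h22 : ¬G.Adj p₂ q₂ := fun h =>
    hG.no_domino h11 hp₁ hq₁ hab hp₂.symm hq₂.symm h hp₁b hp hp₂b.symm hq₁a hq hq₂a.symm
  have hbn : ∀ {t}, G.Adj t b → t = a ∨ t = q₁ ∨ t = q₂ := fun h =>
    hG.eq_of_adj hab.symm hq₁.symm hq₂.symm hq₁a.symm hq₂a.symm hq h.symm
  have han : ∀ {t}, G.Adj t a → t = b ∨ t = p₁ ∨ t = p₂ := fun h =>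
    hG.eq_of_adj hab hp₁.symm hp₂.symm hp₁b.symm hp₂b.symm hp h.symm
  obtain ⟨z, x, y, hpz, hqz, hpx, hqy, hxy, hza, hzb, hxa, hyb, hxz, hyz⟩ :=
    hG.exists_common hab hno hp₂ hq₂ hp₂b hq₂a h22
      (fun w h h' => by
        rcases hbn h' with h' | h' | h'
        · exact h'
        · exact (h21 (h' ▸ h)).elim
        · exact (h22 (h' ▸ h)).elim)
      (fun w h h' => by
        rcases han h' with h' | h' | h'
        · exact h'
        · exact (h12 (h' ▸ h.symm)).elim
        · exact (h22 (h' ▸ h.symm)).elim)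
  have h1 : G.Adj p₁ y := hG.adj_of_square hab hno hp₁ hp₂ hq₁ hq₂ hp hq hp₁b hp₂b hq₁a hq₂a h11
    h12 h22 hpz hqz hpx hqy hxy hza hzb hyb hyz
  have h2 : G.Adj q₁ x := hG.adj_of_square hab.symm hno.symm hq₁ hq₂ hp₁ hp₂ hq hp hq₁a hq₂a hp₁b
    hp₂b h11.symm (fun h => h21 h.symm) (fun h => h22 h.symm) hqz hpz hqy hpx hxy.symm hzb hza hxa
    hxz
  -- The squares `a b q₁ p₁` and `p₁ q₁ x y` share the edge `p₁q₁`.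
  refine hG.no_domino hab hp₁.symm hq₁.symm h11 h1 h2 hxy.symm hq₁a.symm ?_ ?_ hp₁b.symm ?_ ?_
  · rintro rfl; exact tri hab hq₂.symm hqy.symm
  · rintro rfl; exact tri hqy hq₁ hq₂
  · rintro rfl; exact tri hab.symm hp₂.symm hpx.symm
  · rintro rfl; exact tri hpx hp₁ hp₂

theorem IsCritical.exists_common_of_noPath (hG : IsCritical G) {a b p₁ p₂ q₁ q₂ : V}
    (hab : G.Adj a b) (hno : NoPath G a b) (hp₁ : G.Adj p₁ a) (hp₂ : G.Adj p₂ a)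
    (hq₁ : G.Adj q₁ b) (hq₂ : G.Adj q₂ b) (hp : p₁ ≠ p₂) (hq : q₁ ≠ q₂) (hp₁b : p₁ ≠ b)
    (hp₂b : p₂ ≠ b) (hq₁a : q₁ ≠ a) (hq₂a : q₂ ≠ a) :
    ∃ z x y, G.Adj p₁ z ∧ G.Adj q₁ z ∧ G.Adj p₁ x ∧ G.Adj q₁ y ∧ G.Adj x y ∧ z ≠ a ∧ z ≠ b ∧
      x ≠ a ∧ y ≠ b ∧ x ≠ z ∧ y ≠ z := by
  have h11 := hG.not_adj_of_noPath hab hno hp₁ hp₂ hq₁ hq₂ hp hq hp₁b hp₂b hq₁a hq₂a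
  have h12 := hG.not_adj_of_noPath hab hno hp₁ hp₂ hq₂ hq₁ hp hq.symm hp₁b hp₂b hq₂a hq₁a
  have h21 := hG.not_adj_of_noPath hab hno hp₂ hp₁ hq₁ hq₂ hp.symm hq hp₂b hp₁b hq₁a hq₂a
  refine hG.exists_common hab hno hp₁ hq₁ hp₁b hq₁a h11 (fun w h h' => ?_) fun w h h' => ?_
  · rcases hG.eq_of_adj hab.symm hq₁.symm hq₂.symm hq₁a.symm hq₂a.symm hq h'.symm with h' | h' | h'
    · exact h'
    · exact (h11 (h' ▸ h)).elim
    · exact (h12 (h' ▸ h)).elim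
  · rcases hG.eq_of_adj hab hp₁.symm hp₂.symm hp₁b.symm hp₂b.symm hp h'.symm with h' | h' | h'
    · exact h'
    · exact (h11 (h' ▸ h.symm)).elim
    · exact (h21 (h' ▸ h.symm)).elim

/-- If `ab` is in no square and not the centre of an induced path `P₆`, then the two further
neighbours `q₁` and `q₂` of `b` have no common neighbour `z ≠ b` that is adjacent to some `p₁ ∼ a`. -/
theorem IsCritical.false_of_common (hG : IsCritical G) {a b p₁ p₂ q₁ q₂ z : V}
    (hab : G.Adj a b) (hno : NoPath G a b) (hp₁ : G.Adj p₁ a) (hp₂ : G.Adj p₂ a)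
    (hq₁ : G.Adj q₁ b) (hq₂ : G.Adj q₂ b) (hp : p₁ ≠ p₂) (hq : q₁ ≠ q₂) (hp₁b : p₁ ≠ b)
    (hp₂b : p₂ ≠ b) (hq₁a : q₁ ≠ a) (hq₂a : q₂ ≠ a) (hz₁ : G.Adj p₁ z) (hz₂ : G.Adj q₁ z)
    (hz₃ : G.Adj q₂ z) (hzb : z ≠ b) : False := by
  have tri : ∀ {u v w : V}, G.Adj u v → G.Adj v w → ¬G.Adj u w :=
    fun h1 h2 h3 => hG.triangle_free h1 h2 h3
  have h11 := hG.not_adj_of_noPath hab hno hp₁ hp₂ hq₁ hq₂ hp hq hp₁b hp₂b hq₁a hq₂a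
  have h12 := hG.not_adj_of_noPath hab hno hp₁ hp₂ hq₂ hq₁ hp hq.symm hp₁b hp₂b hq₂a hq₁a
  have h21 := hG.not_adj_of_noPath hab hno hp₂ hp₁ hq₁ hq₂ hp.symm hq hp₂b hp₁b hq₁a hq₂a
  have h22 := hG.not_adj_of_noPath hab hno hp₂ hp₁ hq₂ hq₁ hp.symm hq.symm hp₂b hp₁b hq₂a hq₁a
  have hne : ∀ {p q}, G.Adj p a → G.Adj q b → p ≠ q := by
    rintro p q h h' rfl; exact tri h hab h'
  obtain ⟨z', x, y, hpz, hqz, hpx, hqy, hxy, hza, hzb', hxa, hyb, hxz, hyz⟩ :=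
    hG.exists_common_of_noPath hab hno hp₂ hp₁ hq₁ hq₂ hp.symm hq hp₂b hp₁b hq₁a hq₂a
  have hzn : ∀ {t}, G.Adj t z → t = p₁ ∨ t = q₁ ∨ t = q₂ := fun h =>
    hG.eq_of_adj hz₁.symm hz₂.symm hz₃.symm (hne hp₁ hq₁) (hne hp₁ hq₂) hq h.symm
  -- As a neighbour of `q₁` other than `b`, `z` is `z'` or `y`. The first gives `z` a fourth
  -- neighbour `p₂`; the second makes `x` one of `p₁`, `q₁`, `q₂`, none of which is adjacent to
  -- `p₂`.
  rcases hG.eq_of_adj hq₁ hqz hqy hzb'.symm hyb.symm hyz.symm hz₂ with h | h | h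
  · exact hzb h
  · subst h
    rcases hzn hpz with h | h | h
    · exact hp h.symm
    · exact hne hp₂ hq₁ h
    · exact hne hp₂ hq₂ h
  · subst h
    rcases hzn hxy with rfl | rfl | rfl
    · exact tri hpx hp₁ hp₂
    · exact h21 hpx
    · exact h22 hpx

/-- Each pair `pᵢ`, `qⱼ` has a common neighbour, and pairs that share a vertex have different ones.
So these four vertices are the further neighbours of the `pᵢ` and `qⱼ`. The edges `xy` of
`exists_common_of_noPath` join the common neighbours of disjoint pairs, and a Petersen graph
appears. -/
theorem IsCritical.not_noPath (hG : IsCritical G) {a b : V} (hab : G.Adj a b) :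
    ¬NoPath G a b := by
  intro hno
  have tri : ∀ {u v w : V}, G.Adj u v → G.Adj v w → ¬G.Adj u w :=
    fun h1 h2 h3 => hG.triangle_free h1 h2 h3
  obtain ⟨p₁, p₂, hp₁, hp₂, hp, hp₁b, hp₂b⟩ := hG.exists_nbrs hab
  obtain ⟨q₁, q₂, hq₁, hq₂, hq, hq₁a, hq₂a⟩ := hG.exists_nbrs hab.symm
  replace hp₁ := hp₁.symm
  replace hp₂ := hp₂.symm
  replace hq₁ := hq₁.symm
  replace hq₂ := hq₂.symm
  obtain ⟨z₁, x₁, y₁, hpz₁, hqz₁, hpx₁, hqy₁, hxy₁, hz₁a, hz₁b, hx₁a, hy₁b, hxz₁, hyz₁⟩ :=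
    hG.exists_common_of_noPath hab hno hp₁ hp₂ hq₁ hq₂ hp hq hp₁b hp₂b hq₁a hq₂a
  obtain ⟨z₂, x₂, y₂, hpz₂, hqz₂, hpx₂, hqy₂, hxy₂, hz₂a, hz₂b, hx₂a, hy₂b, hxz₂, hyz₂⟩ :=
    hG.exists_common_of_noPath hab hno hp₁ hp₂ hq₂ hq₁ hp hq.symm hp₁b hp₂b hq₂a hq₁a
  obtain ⟨z₃, -, -, hpz₃, hqz₃, -, -, -, hz₃a, hz₃b, -⟩ :=
    hG.exists_common_of_noPath hab hno hp₂ hp₁ hq₁ hq₂ hp.symm hq hp₂b hp₁b hq₁a hq₂a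
  obtain ⟨z₄, -, -, hpz₄, hqz₄, -, -, -, hz₄a, hz₄b, -⟩ :=
    hG.exists_common_of_noPath hab hno hp₂ hp₁ hq₂ hq₁ hp.symm hq.symm hp₂b hp₁b hq₂a hq₁a
  have n12 : z₁ ≠ z₂ := by
    rintro rfl
    exact hG.false_of_common hab hno hp₁ hp₂ hq₁ hq₂ hp hq hp₁b hp₂b hq₁a hq₂a hpz₁ hqz₁ hqz₂ hz₁b
  have n34 : z₃ ≠ z₄ := by
    rintro rfl
    exact hG.false_of_common hab hno hp₂ hp₁ hq₁ hq₂ hp.symm hq hp₂b hp₁b hq₁a hq₂a hpz₃ hqz₃ hqz₄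
      hz₃b
  have n13 : z₁ ≠ z₃ := by
    rintro rfl
    exact hG.false_of_common hab.symm hno.symm hq₁ hq₂ hp₁ hp₂ hq hp hq₁a hq₂a hp₁b hp₂b hqz₁ hpz₁
      hpz₃ hz₁a
  have n24 : z₂ ≠ z₄ := by
    rintro rfl
    exact hG.false_of_common hab.symm hno.symm hq₂ hq₁ hp₁ hp₂ hq.symm hp hq₂a hq₁a hp₁b hp₂b hqz₂
      hpz₂ hpz₄ hz₂a
  have e1 : x₁ = z₂ := by
    have := hG.eq_of_adj hp₁ hpz₁ hpz₂ hz₁a.symm hz₂a.symm n12 hpx₁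
    tauto
  have e2 : y₁ = z₃ := by
    have := hG.eq_of_adj hq₁ hqz₁ hqz₃ hz₁b.symm hz₃b.symm n13 hqy₁
    tauto
  have e3 : x₂ = z₁ := by
    have := hG.eq_of_adj hp₁ hpz₁ hpz₂ hz₁a.symm hz₂a.symm n12 hpx₂
    tauto
  have e4 : y₂ = z₄ := by
    have := hG.eq_of_adj hq₂ hqz₂ hqz₄ hz₂b.symm hz₄b.symm n24 hqy₂
    tauto
  subst e1 e2 e3 e4
  have hpq : ∀ {p q}, G.Adj p a → G.Adj q b → p ≠ q := by
    rintro p q h h' rfl; exact tri h hab h'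
  have hpz : ∀ {p p' z}, G.Adj p a → G.Adj p' a → G.Adj p z → p' ≠ z := by
    rintro p p' z h h' h'' rfl; exact tri h'' h' h
  have hqz : ∀ {q q' z}, G.Adj q b → G.Adj q' b → G.Adj q z → q' ≠ z := by
    rintro p p' z h h' h'' rfl; exact tri h'' h' h
  -- The omitted vertex is `a`. After the substitutions `x₂`, `x₁`, `y₁`, `y₂` stand for `z₁`, `z₂`,
  -- `z₃`, `z₄`.
  refine hG.not_isEmbedding_petersen ![p₁, x₂, y₂, p₂, b, x₁, q₁, q₂, y₁] ⟨?_, ?_⟩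
  · have := hpq hp₁ hq₁; have := hpq hp₁ hq₂; have := hpq hp₂ hq₁; have := hpq hp₂ hq₂
    have := hpz hp₁ hp₁ hpz₁; have := hpz hp₁ hp₁ hpz₂; have := hpz hp₁ hp₂ hpz₁
    have := hpz hp₁ hp₂ hpz₂; have := hpz hp₂ hp₁ hpz₃; have := hpz hp₂ hp₁ hpz₄
    have := hpz hp₂ hp₂ hpz₃; have := hpz hp₂ hp₂ hpz₄
    have := hqz hq₁ hq₁ hqz₁; have := hqz hq₁ hq₂ hqz₁; have := hqz hq₂ hq₁ hqz₂
    have := hqz hq₂ hq₂ hqz₂; have := hqz hq₁ hq₁ hqz₃; have := hqz hq₁ hq₂ hqz₃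
    have := hqz hq₂ hq₁ hqz₄; have := hqz hq₂ hq₂ hqz₄
    have := hq₁.ne; have := hq₂.ne; have := hxy₁.ne; have := hxy₂.ne
    rw [← List.nodup_ofFn]
    simp only [List.ofFn_succ, List.ofFn_zero, List.nodup_cons, List.mem_cons, List.not_mem_nil,
      List.nodup_nil, Matrix.cons_val_zero, Matrix.cons_val_succ, not_or, not_false_eq_true,
      or_false, and_true]
    constructorm* _ ∧ _ <;> first | assumption | exact Ne.symm ‹_›
  · simp [petersenEdges, hq₁.symm, hpz₄.symm, hqz₁.symm, hqz₂.symm, hqz₄.symm, hxy₁.symm, *]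

/-- Vertices at distance two along the path are nonadjacent because there are no triangles; the
other nonadjacencies are those listed in `NoPath`. -/
theorem IsCritical.exists_path (hG : IsCritical G) {a b : V} (hab : G.Adj a b) :
    ∃ f : SimpleGraph.pathGraph 6 ↪g G, f 2 = a ∧ f 3 = b := by
  have tri : ∀ {u v w : V}, G.Adj u v → G.Adj v w → ¬G.Adj u w :=
    fun h1 h2 h3 => hG.triangle_free h1 h2 h3
  have h := hG.not_noPath hab
  simp only [NoPath, not_forall] at h
  obtain ⟨x, p, q, y, hpa, hqb, hxp, hyq, hxa, hyb, hpb, hqa, hpq, hxb, hya, hxq, hyp, hxy, -⟩ := h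
  have t1 := tri hxp hpa
  have t2 := tri hpa hab
  have t3 := tri hab hqb.symm
  have t4 := tri hqb.symm hyq.symm
  have n1 : x ≠ b := by rintro rfl; exact tri hpa hab hxp.symm
  have n2 : x ≠ q := by rintro rfl; exact hpq hxp.symm
  have n3 : x ≠ y := by rintro rfl; exact hxq hyq
  have n4 : p ≠ q := by rintro rfl; exact t2 hqb
  have n5 : p ≠ y := by rintro rfl; exact hya hpa
  have n6 : a ≠ y := by rintro rfl; exact t3 hyq
  have := hpa.ne; have := hqb.ne; have := hxp.ne; have := hyq.ne; have := hab.ne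
  refine ⟨⟨⟨![x, p, a, b, q, y], ?_⟩, ?_⟩, rfl, rfl⟩
  · intro i j h
    fin_cases i <;> fin_cases j <;> simp_all [eq_comm]
  · have c : ∀ {u v : V}, ¬G.Adj u v → ¬G.Adj v u := fun h h' => h h'.symm
    have := c t1; have := c t2; have := c t3; have := c t4; have := c hpq; have := c hxb
    have := c hya; have := c hxq; have := c hyp; have := c hxy
    have := hpa.symm; have := hqb.symm; have := hxp.symm; have := hyq.symm; have := hab.symm
    intro i j
    rw [SimpleGraph.pathGraph_adj]
    change G.Adj (![x, p, a, b, q, y] i) (![x, p, a, b, q, y] j) ↔ _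
    fin_cases i <;> fin_cases j <;> simp [*]

end Consequences

/-! ### The configurations in terms of `SimpleGraph.IsContained` -/

section Containment

variable {V : Type u} [Fintype V] {G : SimpleGraph V}

theorem IsCritical.not_isContained_triangle (hG : IsCritical G) : ¬triangle.IsContained G := by
  rintro ⟨f⟩
  have h : ∀ i j : Fin 3, i ≠ j → G.Adj (f i) (f j) := fun i j hij => f.toHom.map_rel hij
  exact hG.triangle_free (h 0 1 (by decide)) (h 1 2 (by decide)) (h 0 2 (by decide))

theorem IsCritical.not_isContained_k23 (hG : IsCritical G) : ¬k23.IsContained G := by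
  rintro ⟨f⟩
  have h : ∀ i j, G.Adj (f (.inl i)) (f (.inr j)) := fun i j => f.toHom.map_rel (by simp [k23])
  have hr : ∀ i j, i ≠ j → f (.inr i) ≠ f (.inr j) := fun i j hij => f.injective.ne (by simpa)
  exact hG.no_k23 (h 0 0) (h 0 1) (h 0 2) (h 1 0) (h 1 1) (h 1 2) (f.injective.ne (by simp))
    (hr _ _ (by decide)) (hr _ _ (by decide)) (hr _ _ (by decide))

theorem IsCritical.not_isContained_petersen (hG : IsCritical G) :
    ¬petersenMinusVertex.IsContained G := by
  rintro ⟨f⟩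
  refine hG.not_isEmbedding_petersen (fun i => f ⟨i.succ, i.succ_ne_zero⟩) ⟨?_, ?_⟩
  · intro i j h
    simpa using f.injective h
  · have h : ∀ e ∈ petersenEdges, petersen.Adj e.1.succ e.2.succ := by
      simp [petersenEdges, petersen]
    exact fun e he => f.toHom.map_rel (h e he)

theorem IsCritical.not_isContained_clawSquare (hG : IsCritical G) :
    ¬clawSquare.IsContained G := by
  rintro ⟨f⟩
  have h : ∀ e ∈ clawSquareEdges, clawSquare.Adj e.1 e.2 := by simp [clawSquareEdges, clawSquare]
  exact hG.not_isEmbedding_clawSquare f ⟨f.injective, fun e he => f.toHom.map_rel (h e he)⟩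

theorem IsCritical.not_isContained_twinHouse (hG : IsCritical G) :
    ¬twinHouse.IsContained G := by
  rintro ⟨f⟩
  have h : ∀ e ∈ twinHouseEdges, twinHouse.Adj e.1 e.2 := by simp [twinHouseEdges, twinHouse]
  exact hG.not_isEmbedding_twinHouse f ⟨f.injective, fun e he => f.toHom.map_rel (h e he)⟩

theorem IsCritical.not_isContained_domino (hG : IsCritical G) : ¬domino.IsContained G := by
  rintro ⟨f⟩
  have h : ∀ e ∈ dominoEdges, domino.Adj e.1 e.2 := by simp [dominoEdges, domino]
  exact hG.not_isEmbedding_domino f ⟨f.injective, fun e he => f.toHom.map_rel (h e he)⟩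

end Containment

end ThreeDecomposition

theorem mainTheorem4 {V : Type*} [Fintype V] (G : SimpleGraph V) [DecidableRel G.Adj]
    (hG : ThreeDecomposition.IsMinimumCounterexample G) :
    -- no reducible configuration is a (not necessarily induced) subgraph
    (¬ ThreeDecomposition.triangle.IsContained G ∧
      ¬ ThreeDecomposition.k23.IsContained G ∧
      ¬ ThreeDecomposition.petersenMinusVertex.IsContained G ∧
      ¬ ThreeDecomposition.clawSquare.IsContained G ∧
      ¬ ThreeDecomposition.twinHouse.IsContained G ∧
      ¬ ThreeDecomposition.domino.IsContained G) ∧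
    4 ≤ G.egirth ∧
    (∀ (v : V) (c : G.Walk v v), c.IsCycle →
      (c.length = 4 ∨ c.length = 5 ∨ c.length = 6) → c.toSubgraph.IsInduced) ∧
    (∀ e ∈ G.edgeSet, ∃ f : SimpleGraph.pathGraph 6 ↪g G, s(f 2, f 3) = e) := by
  have h := hG.isCritical
  refine ⟨⟨h.not_isContained_triangle, h.not_isContained_k23, h.not_isContained_petersen,
    h.not_isContained_clawSquare, h.not_isContained_twinHouse, h.not_isContained_domino⟩,
    h.four_le_egirth, fun v c hc hl => h.isInduced_toSubgraph hc hl, fun e => ?_⟩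
  induction e with
  | _ a b =>
    intro hab
    obtain ⟨f, rfl, rfl⟩ := h.exists_path hab
    exact ⟨f, rfl⟩
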